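/- Let $R$ be a complete discrete valuation ring with maximal ideal $\mathfrak p$, finite residue field $k$ of odd characteristic, and fraction field $F$ (for instance the completion $\mathcal O_{\mathfrak p}$ of the ring of integers of a number field at a prime $\mathfrak p\nmid 2$). Fix a uniformizer $\pi$ of $R$ and an element $\delta\in R$ whose residue class is not a square in $k$. *Definitions.* An order in a quaternion algebra over $F$ is a unital subring which is a full $R$-lattice. A maximal suborder of an order $O$ is an order $O'\subsetneq O$ such that no order lies strictly between $O'$ and $O$. We write $\langle 1,a,b\rangle$ for the form $x^2+ay^2+bz^2$; an order $O$ corresponds to $\langle 1,a,b\rangle$ if it is isomorphic, as an $R$-algebra, to the even Clifford algebra $C_0(\langle 1,a,b\rangle)$ over $R$. The Bass forms are $$\langle 1,-1,\pi^s\rangle\ (s\ge 0),\quad \langle 1,-\delta,\pi^s\rangle\ (s\ge 1),\quad \langle 1,\pi,\epsilon_1\pi\rangle,\quad \langle 1,\epsilon_1\pi,\epsilon_2\pi^s\rangle\ (s\ge 2),\qquad \epsilon_1,\epsilon_2\in\{1,\delta\}.$$ A Bass form $g$ is beneath a Bass form $f$ if, in some quaternion algebra over $F$, there are an order $O$ corresponding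 to $f$ and a maximal suborder $O'$ of $O$ corresponding to $g$. Let $f=\langle 1,a,b\rangle$ be a Bass form and $O$ an order corresponding to $f$. A good basis of $O$ is an $R$-basis $\{1,e_1,e_2,e_3\}$ with $$e_1^2=-ab,\quad e_2^2=-b,\quad e_3^2=-a,\quad e_1e_2=-be_3=-e_2e_1,\quad e_2e_3=-e_1=-e_3e_2,\quad e_3e_1=-ae_2=-e_1e_3.$$ A quasi-good basis of $O$ is an $R$-basis $\{1,e_1,e_2,e_3\}$ for which there is a good basis $\{1,\tilde e_1,\tilde e_2,\tilde e_3\}$ of $O$ with $\tilde e_i\equiv e_i \pmod{\mathfrak pO}$ for $i=1,2,3$. *Table of suborders.* Here $\alpha_0,\alpha_1,\beta_0,\beta_1,\mu,\nu$ denote any elements of $R$ with $\alpha_0^2-\alpha_1^2=\pi$, $\beta_0^2+\beta_1^2=\delta$, $\mu^2=-1$ (when $-1$ is a square in $k$), $\nu^2=-\delta$ (when $-1$ is not a square in $k$). Each row lists $f$, then $g$, then $(d_1,d_2,d_3)$. 1. $\langle 1,-1,\pi^s\rangle$, $\langle 1,-1,\pi^{s+1}\rangle$ ($s\ge0$): $(\alpha_0e_1+\alpha_1e_2,\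 \alpha_1e_1+\alpha_0e_2,\ e_3)$. 2. $\langle 1,-1,1\rangle$, $\langle 1,-\delta,\pi^2\rangle$: $(\pi(\beta_1e_1-\beta_0e_3),\ \pi e_2,\ \beta_0e_1+\beta_1e_3)$. 3. $\langle 1,-1,\pi\rangle$, $\langle 1,\pi,\pi\rangle$, if $-1$ is a square in $k$: $(\mu\pi e_3,\ \mu e_1,\ e_2)$. 4. $\langle 1,-1,\pi\rangle$, $\langle 1,\pi,\delta\pi\rangle$, if $-1$ is not a square in $k$: $(\nu\pi e_3,\ \nu e_1,\ e_2)$. 5. $\langle 1,-\delta,\pi^s\rangle$, $\langle 1,-\delta,\pi^{s+2}\rangle$ ($s\ge1$): $(\pi e_1,\ \pi e_2,\ e_3)$. 6. $\langle 1,-\delta,\pi\rangle$, $\langle 1,\pi,\delta\pi\rangle$, if $-1$ is a square in $k$: $(\mu\pi e_3,\ \mu e_1,\ e_2)$. 7. $\langle 1,-\delta,\pi\rangle$, $\langle 1,\pi,\pi\rangle$, if $-1$ is not a square in $k$: $(\nu^{-1}\pi e_3,\ \nu^{-1}e_1,\ e_2)$. 8. $\langle 1,\pi,\pi\rangle$,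 $\langle 1,\pi,\pi^2\rangle$: $(\pi e_2,\ e_1,\ e_3)$. 9. $\langle 1,\pi,\pi\rangle$, $\langle 1,\delta\pi,\pi^2\rangle$: $(\pi(-\beta_1e_2+\beta_0e_3),\ e_1,\ \beta_0e_2+\beta_1e_3)$. 10. $\langle 1,\pi,\delta\pi\rangle$, $\langle 1,\pi,\delta\pi^2\rangle$: $(\pi e_2,\ e_1,\ e_3)$. 11. $\langle 1,\pi,\delta\pi\rangle$, $\langle 1,\delta\pi,\delta\pi^2\rangle$: $(\pi e_3,\ e_1,\ e_2)$. 12. $\langle 1,\pi,\pi^s\rangle$, $\langle 1,\pi,\pi^{s+1}\rangle$ ($s\ge2$): $(\pi e_2,\ e_1,\ e_3)$. 13. $\langle 1,\delta\pi,\pi^s\rangle$, $\langle 1,\delta\pi,\delta\pi^{s+1}\rangle$ ($s\ge2$): $(\delta\pi e_2,\ e_1,\ e_3)$. 14. $\langle 1,\pi,\delta\pi^s\rangle$, $\langle 1,\pi,\delta\pi^{s+1}\rangle$ ($s\ge2$): $(\pi e_2,\ e_1,\ e_3)$. 15. $\langle 1,\delta\pi,\delta\pi^s\rangle$, $\langle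 1,\delta\pi,\pi^{s+1}\rangle$ ($s\ge2$): $(\delta\pi e_2,\ \delta^{-1}e_1,\ e_3)$. **Proposition.** Let $O$ be an order in a quaternion algebra over $F$ corresponding to a Bass form $f$, let $\{1,e_1,e_2,e_3\}$ be a quasi-good basis of $O$, and let $g$ be a form beneath $f$. Then the table has a row for the pair $(f,g)$, its auxiliary elements exist in $R$, and for every $d_1,d_2,d_3$ given by that row (with any choice of the auxiliary elements) the $R$-span $\langle 1,d_1,d_2,d_3\rangle_R$ is a maximal suborder of $O$ corresponding to $g$. -/

import Mathlib

universe u v w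

/-- A quaternion algebra over the field `F`: a central simple algebra of dimension four. -/
structure IsQuaternionAlgebra (F : Type u) (B : Type w) [Field F] [Ring B] [Algebra F B] :
    Prop where
  central : Algebra.IsCentral F B
  simple : IsSimpleRing B
  finrank_eq : Module.finrank F B = 4

section Orders

variable {R : Type v} (F : Type u) {B : Type w} [CommRing R] [Field F] [Algebra R F]
  [Ring B] [Algebra F B] [Algebra R B] [IsScalarTower R F B]

/-- An `R`-order in the `F`-algebra `B`: a unital subring which is a full `R`-lattice, that is,
finitely generated over `R` and spanning `B` over `F`. -/
def IsOrder (O : Subalgebra R B) : Prop :=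
  Submodule.IsLattice F (Subalgebra.toSubmodule O)

/-- `O'` is a maximal suborder of `O`: it is an order properly contained in `O`, and there is no
order strictly between `O'` and `O`. -/
def IsMaximalSuborder (O' O : Subalgebra R B) : Prop :=
  IsOrder F O' ∧ O' < O ∧
    ∀ O'' : Subalgebra R B, IsOrder F O'' → O' < O'' → O'' ≤ O → O'' = O

end Orders

section Forms

variable {R : Type v} [CommRing R]

/-- The ternary quadratic form `⟨1, a, b⟩`, i.e. `x² + a y² + b z²`. -/
def ternaryForm (a b : R) : QuadraticForm R (Fin 3 → R) :=
  QuadraticMap.weightedSumSquares R ![1, a, b]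

/-- The order `O` is in correspondence with the form `⟨1, a, b⟩`: it is isomorphic to the order
`C₀(⟨1, a, b⟩)`, the even part of the Clifford algebra of the form over `R`. -/
def Corresponds {B : Type w} [Ring B] [Algebra R B] (O : Subalgebra R B) (a b : R) : Prop :=
  Nonempty (O ≃ₐ[R] CliffordAlgebra.even (ternaryForm a b))

/-- The pairs `(a, b)` for which `⟨1, a, b⟩` is one of the ternary forms which classify the Bass
orders (classes A1, A2, B, C). Here `π` is a uniformizer and `δ` a nonsquare unit. -/
inductive IsBassForm (π δ : R) : R → R → Prop
  | A1 (s : ℕ) : IsBassForm π δ (-1) (π ^ s)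
  | A2 (s : ℕ) (hs : 1 ≤ s) : IsBassForm π δ (-δ) (π ^ s)
  | B (ε₁ : R) (h₁ : ε₁ = 1 ∨ ε₁ = δ) : IsBassForm π δ π (ε₁ * π)
  | C (ε₁ ε₂ : R) (h₁ : ε₁ = 1 ∨ ε₁ = δ) (h₂ : ε₂ = 1 ∨ ε₂ = δ) (s : ℕ) (hs : 2 ≤ s) :
      IsBassForm π δ (ε₁ * π) (ε₂ * π ^ s)

/-- The form `⟨1, a', b'⟩` is beneath the form `⟨1, a, b⟩`: both belong to the list of Bass forms,
and in some quaternion algebra over `F` there are an order `O` corresponding to `⟨1, a, b⟩` and a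
maximal suborder `O'` of `O` corresponding to `⟨1, a', b'⟩`. -/
def IsBeneath (F : Type u) [Field F] [Algebra R F] (π δ a b a' b' : R) : Prop :=
  IsBassForm π δ a b ∧ IsBassForm π δ a' b' ∧
    ∃ (B : Type u) (_ : Ring B) (_ : Algebra F B) (_ : Algebra R B) (_ : IsScalarTower R F B),
      IsQuaternionAlgebra F B ∧
        ∃ O O' : Subalgebra R B, IsOrder F O ∧ Corresponds O a b ∧
          IsMaximalSuborder F O' O ∧ Corresponds O' a' b'

/-- A basis `{1, e₁, e₂, e₃}` of an order `O` is good for the form `⟨1, a, b⟩` if it satisfies the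
multiplication table attached to this form. -/
structure IsGoodBasis {B : Type w} [Ring B] [Algebra R B] {O : Subalgebra R B} (a b : R)
    (e : Module.Basis (Fin 4) R O) : Prop where
  e0 : e 0 = 1
  e11 : e 1 * e 1 = algebraMap R O (-(a * b))
  e22 : e 2 * e 2 = algebraMap R O (-b)
  e33 : e 3 * e 3 = algebraMap R O (-a)
  e12 : e 1 * e 2 = -(b • e 3)
  e23 : e 2 * e 3 = -e 1
  e31 : e 3 * e 1 = -(a • e 2)
  e21 : e 2 * e 1 = b • e 3
  e32 : e 3 * e 2 = e 1
  e13 : e 1 * e 3 = a • e 2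

/-- A basis `{1, e₁, e₂, e₃}` of an order `O` is quasi-good for the form `⟨1, a, b⟩` if it is
congruent modulo `𝔭 O` to a good basis of `O`. -/
def IsQuasiGoodBasis [IsLocalRing R] {B : Type w} [Ring B] [Algebra R B] {O : Subalgebra R B}
    (a b : R) (e : Module.Basis (Fin 4) R O) : Prop :=
  e 0 = 1 ∧ ∃ e' : Module.Basis (Fin 4) R O, IsGoodBasis a b e' ∧
    ∀ i : Fin 4, i ≠ 0 → e' i - e i ∈ IsLocalRing.maximalIdeal R • (⊤ : Submodule R O)

/-- The table of suborders. `SuborderTable π δ e₁ e₂ e₃ a b a' b' d₁ d₂ d₃` says that the table has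
a row for the form `⟨1, a, b⟩` and the form `⟨1, a', b'⟩` beneath it, and that this row, for some
admissible choice of the auxiliary elements `α₀, α₁, β₀, β₁, μ, ν` of `R`, gives the elements
`d₁, d₂, d₃` in terms of `e₁, e₂, e₃`. The conditions on the quadratic character of `-1` are
expressed in the residue field. -/
inductive SuborderTable [IsLocalRing R] {M : Type w} [AddCommGroup M] [Module R M]
    (π δ : R) (e₁ e₂ e₃ : M) : R → R → R → R → M → M → M → Prop
  | A1_A1 (s : ℕ) (α₀ α₁ : R) (hα : α₀ ^ 2 - α₁ ^ 2 = π) :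
      SuborderTable π δ e₁ e₂ e₃ (-1) (π ^ s) (-1) (π ^ (s + 1))
        (α₀ • e₁ + α₁ • e₂) (α₁ • e₁ + α₀ • e₂) e₃
  | A1_A2 (β₀ β₁ : R) (hβ : β₀ ^ 2 + β₁ ^ 2 = δ) :
      SuborderTable π δ e₁ e₂ e₃ (-1) 1 (-δ) (π ^ 2)
        (π • (β₁ • e₁ - β₀ • e₃)) (π • e₂) (β₀ • e₁ + β₁ • e₃)
  | A1_B_one (h : IsSquare (-1 : IsLocalRing.ResidueField R)) (μ : R) (hμ : μ ^ 2 = -1) :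
      SuborderTable π δ e₁ e₂ e₃ (-1) π π π
        ((μ * π) • e₃) (μ • e₁) e₂
  | A1_B_delta (h : ¬ IsSquare (-1 : IsLocalRing.ResidueField R)) (ν : R) (hν : ν ^ 2 = -δ) :
      SuborderTable π δ e₁ e₂ e₃ (-1) π π (δ * π)
        ((ν * π) • e₃) (ν • e₁) e₂
  | A2_A2 (s : ℕ) (hs : 1 ≤ s) :
      SuborderTable π δ e₁ e₂ e₃ (-δ) (π ^ s) (-δ) (π ^ (s + 2))
        (π • e₁) (π • e₂) e₃
  | A2_B_delta (h : IsSquare (-1 : IsLocalRing.ResidueField R)) (μ : R) (hμ : μ ^ 2 = -1) :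
      SuborderTable π δ e₁ e₂ e₃ (-δ) π π (δ * π)
        ((μ * π) • e₃) (μ • e₁) e₂
  | A2_B_one (h : ¬ IsSquare (-1 : IsLocalRing.ResidueField R)) (ν : R) (hν : ν ^ 2 = -δ) :
      SuborderTable π δ e₁ e₂ e₃ (-δ) π π π
        ((Ring.inverse ν * π) • e₃) (Ring.inverse ν • e₁) e₂
  | B_one_C_one :
      SuborderTable π δ e₁ e₂ e₃ π π π (π ^ 2)
        (π • e₂) e₁ e₃
  | B_one_C_delta (β₀ β₁ : R) (hβ : β₀ ^ 2 + β₁ ^ 2 = δ) :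
      SuborderTable π δ e₁ e₂ e₃ π π (δ * π) (π ^ 2)
        (π • (-(β₁ • e₂) + β₀ • e₃)) e₁ (β₀ • e₂ + β₁ • e₃)
  | B_delta_C_one :
      SuborderTable π δ e₁ e₂ e₃ π (δ * π) π (δ * π ^ 2)
        (π • e₂) e₁ e₃
  | B_delta_C_delta :
      SuborderTable π δ e₁ e₂ e₃ π (δ * π) (δ * π) (δ * π ^ 2)
        (π • e₃) e₁ e₂
  | C_one_one (s : ℕ) (hs : 2 ≤ s) :
      SuborderTable π δ e₁ e₂ e₃ π (π ^ s) π (π ^ (s + 1))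
        (π • e₂) e₁ e₃
  | C_delta_one (s : ℕ) (hs : 2 ≤ s) :
      SuborderTable π δ e₁ e₂ e₃ (δ * π) (π ^ s) (δ * π) (δ * π ^ (s + 1))
        ((δ * π) • e₂) e₁ e₃
  | C_one_delta (s : ℕ) (hs : 2 ≤ s) :
      SuborderTable π δ e₁ e₂ e₃ π (δ * π ^ s) π (δ * π ^ (s + 1))
        (π • e₂) e₁ e₃
  | C_delta_delta (s : ℕ) (hs : 2 ≤ s) :
      SuborderTable π δ e₁ e₂ e₃ (δ * π) (δ * π ^ s) (δ * π) (π ^ (s + 1))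
        ((δ * π) • e₂) (Ring.inverse δ • e₁) e₃

end Forms

/-! The order of `⟨1, a, b⟩` is the quaternion order with `i² = -a`, `j² = -b`, so both halves are
computations there.

Existence of a row. A maximal suborder becomes a maximal subalgebra `S` of `ℍ[R,-a,-b]` isomorphic
to `ℍ[R,-a',-b']`. The images `p`, `q` of its generators are pure and orthogonal, of norms `a'`,
`b'`; if `D` is the determinant of `p, q, pq`, multiplicativity of the norm gives `abD = a'b'`. By
Nakayama `S` contains `π` times the whole order, and pairing with the cross product of `p` and `q`
yields `D ∣ π²`; properness excludes a unit `D`. If `D` is associated to `π²`, then `S` modulo `π`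
is spanned by `1` and `p`, and maximality produces a right ideal of dimension at most one modulo
`π`, hence strong congruences (`SuborderCoords.nonempty`). Comparing valuations in `abD = a'b'`
fixes the exponent of `g`, and reducing the norm equations modulo `π` fixes the square classes of
its units; only the pairs in the table survive (`SuborderTable.exists_row`). Hensel's lemma supplies
the `β`, `μ`, `ν`.

Validity of the rows. The span `N` of `1, d₁, d₂, d₃` contains `πO`, so a quasi-good basis may be
replaced by a good one, where the multiplication table of `g` is checked directly. Modulo `N`, the
order `O` is generated by one element `v` over `R[d₃]`. Either one coordinate suffices, or `d₃`
generates the quadratic extension of the residue field; in both cases any nonzero class recovers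
`v`, so no order lies strictly between (`exists_isMaximalSuborder`). -/

open Quaternion

/-! ### Even Clifford algebras of ternary forms as quaternion orders -/

section EvenClifford

variable {R : Type*} [CommRing R]

/-- The homomorphism of even Clifford algebras induced by an isometry. -/
def CliffordAlgebra.evenMap {M₁ M₂ : Type*} [AddCommGroup M₁] [AddCommGroup M₂] [Module R M₁]
    [Module R M₂] {Q₁ : QuadraticForm R M₁} {Q₂ : QuadraticForm R M₂} (f : Q₁ →qᵢ Q₂) :
    CliffordAlgebra.even Q₁ →ₐ[R] CliffordAlgebra.even Q₂ :=
  CliffordAlgebra.even.lift Q₁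
    { bilin := (CliffordAlgebra.even.ι Q₂).bilin.compl₁₂ f.toLinearMap f.toLinearMap
      contract := fun m => by
        simpa using (CliffordAlgebra.even.ι Q₂).contract (f m)
      contract_mid := fun m₁ m₂ m₃ => by
        simpa using (CliffordAlgebra.even.ι Q₂).contract_mid (f m₁) (f m₂) (f m₃) }

theorem CliffordAlgebra.evenMap_ι {M₁ M₂ : Type*} [AddCommGroup M₁] [AddCommGroup M₂] [Module R M₁]
    [Module R M₂] {Q₁ : QuadraticForm R M₁} {Q₂ : QuadraticForm R M₂} (f : Q₁ →qᵢ Q₂) (x y : M₁) :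
    CliffordAlgebra.evenMap f ((CliffordAlgebra.even.ι Q₁).bilin x y) =
      (CliffordAlgebra.even.ι Q₂).bilin (f x) (f y) := by
  rw [CliffordAlgebra.evenMap, CliffordAlgebra.even.lift_ι]
  rfl

/-- Isometric quadratic forms have isomorphic even Clifford algebras. -/
def CliffordAlgebra.evenEquivOfIsometry {M₁ M₂ : Type*} [AddCommGroup M₁] [AddCommGroup M₂]
    [Module R M₁] [Module R M₂] {Q₁ : QuadraticForm R M₁} {Q₂ : QuadraticForm R M₂}
    (f : Q₁.IsometryEquiv Q₂) : CliffordAlgebra.even Q₁ ≃ₐ[R] CliffordAlgebra.even Q₂ :=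
  AlgEquiv.ofAlgHom (CliffordAlgebra.evenMap f.toIsometry)
    (CliffordAlgebra.evenMap f.symm.toIsometry)
    (by
      ext x y
      simp [CliffordAlgebra.EvenHom.compr₂, CliffordAlgebra.evenMap_ι])
    (by
      ext x y
      simp [CliffordAlgebra.EvenHom.compr₂, CliffordAlgebra.evenMap_ι])

/-- The negative of `⟨1, a, b⟩` is the form `⟨-a, -b⟩ ⊥ ⟨-1⟩`. -/
def negTernaryFormIsometry (a b : R) : (-ternaryForm a b).IsometryEquiv
    (CliffordAlgebra.EquivEven.Q' (CliffordAlgebraQuaternion.Q (-a) (-b))) where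
  toFun x := ((x 1, x 2), x 0)
  invFun y := ![y.2, y.1.1, y.1.2]
  map_add' _ _ := rfl
  map_smul' _ _ := rfl
  left_inv x := by
    ext i
    fin_cases i <;> rfl
  right_inv y := by simp
  map_app' x := by
    simp [ternaryForm, QuadraticMap.weightedSumSquares_apply, Fin.sum_univ_three]
    ring

/-- The order `C₀(⟨1, a, b⟩)` is the quaternion order with `i² = -a` and `j² = -b`. -/
def evenTernaryFormEquiv (a b : R) :
    CliffordAlgebra.even (ternaryForm a b) ≃ₐ[R] ℍ[R,-a,-b] :=
  -- Negating the form preserves the even algebra; splitting off `⟨-1⟩` then turns it into the full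
  -- Clifford algebra of the binary form `⟨-a, -b⟩`.
  (CliffordAlgebra.evenEquivEvenNeg _).trans <|
    (CliffordAlgebra.evenEquivOfIsometry (negTernaryFormIsometry a b)).trans <|
      (CliffordAlgebra.equivEven _).symm.trans CliffordAlgebraQuaternion.equiv

end EvenClifford

/-! ### Maximal subalgebras modulo the maximal ideal -/

section Coatoms

variable {R : Type*} [CommRing R] {A : Type*} [Ring A] [Algebra R A]

/-- The subalgebra `S + π A`. -/
def Subalgebra.addSMulTop (S : Subalgebra R A) (π : R) : Subalgebra R A where
  carrier := {t | ∃ s ∈ S, ∃ g : A, t = s + π • g}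
  mul_mem' := by
    rintro _ _ ⟨s, hs, g, rfl⟩ ⟨s', hs', g', rfl⟩
    refine ⟨s * s', mul_mem hs hs', s * g' + g * s' + π • (g * g'), ?_⟩
    simp only [add_mul, mul_add, smul_mul_assoc, mul_smul_comm, smul_add]
    abel
  add_mem' := by
    rintro _ _ ⟨s, hs, g, rfl⟩ ⟨s', hs', g', rfl⟩
    exact ⟨s + s', add_mem hs hs', g + g', by rw [smul_add]; abel⟩
  algebraMap_mem' r := ⟨_, S.algebraMap_mem r, 0, by simp⟩

/-- The subalgebra `R + w A + π A`. -/
def Subalgebra.rightIdealAdd (w : A) (π : R) : Subalgebra R A where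
  carrier := {t | ∃ (r : R) (h g : A), t = r • 1 + w * h + π • g}
  mul_mem' := by
    rintro _ _ ⟨r, h, g, rfl⟩ ⟨r', h', g', rfl⟩
    refine ⟨r * r', r • h' + r' • h + h * (w * h'),
      r • g' + w * (h * g') + r' • g + g * (w * h') + π • (g * g'), ?_⟩
    simp only [add_mul, mul_add, smul_mul_assoc, mul_smul_comm, smul_add, one_mul, mul_one,
      mul_assoc]
    module
  add_mem' := by
    rintro _ _ ⟨r, h, g, rfl⟩ ⟨r', h', g', rfl⟩
    exact ⟨r + r', h + h', g + g', by rw [mul_add]; module⟩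
  algebraMap_mem' r := ⟨r, 0, 0, by simp [Algebra.algebraMap_eq_smul_one]⟩

/-- A maximal subalgebra of a finite algebra over a local ring contains `π A` for all `π` in the
maximal ideal. -/
theorem IsCoatom.smul_mem_of_mem_maximalIdeal [IsLocalRing R] [Module.Finite R A]
    {S : Subalgebra R A} (hS : IsCoatom S) {π : R} (hπ : π ∈ IsLocalRing.maximalIdeal R) (g : A) :
    π • g ∈ S := by
  have hle : S ≤ S.addSMulTop π := fun s hs => ⟨s, hs, 0, by simp⟩
  have hmem : π • g ∈ S.addSMulTop π := ⟨0, zero_mem S, g, by simp⟩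
  rcases hS.le_iff.1 hle with h | h
  · exfalso
    -- Nakayama: `S + πA = A` would force `S = A`.
    have key : (⊤ : Submodule R A) ≤ Subalgebra.toSubmodule S := by
      refine Submodule.le_of_le_smul_of_le_jacobson_bot (I := IsLocalRing.maximalIdeal R)
        Module.Finite.fg_top (IsLocalRing.maximalIdeal_le_jacobson _) ?_
      intro t _
      obtain ⟨s, hs, g, rfl⟩ : t ∈ S.addSMulTop π := h ▸ Algebra.mem_top
      exact Submodule.add_mem_sup hs (Submodule.smul_mem_smul hπ Submodule.mem_top)
    exact hS.1 (top_le_iff.1 fun t _ => key Submodule.mem_top)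
  · rwa [h] at hmem

/-- If a maximal subalgebra `S` is contained in `R + R w + π A`, where `w (w - α) ∈ π A`, then
`w` or `w - α` generates modulo `π` a right ideal of dimension at most one. -/
theorem IsCoatom.exists_right_eigenvector [IsLocalRing R] {S : Subalgebra R A} (hS : IsCoatom S)
    {π : R} (hπ : IsLocalRing.maximalIdeal R = Ideal.span {π}) {w : A} {α : R}
    (hw : ∃ g : A, w * w = α • w + π • g)
    (hSw : ∀ t ∈ S, ∃ (r s : R) (g : A), t = r • 1 + s • w + π • g) :
    (∀ y, ∃ (l : R) (g : A), w * y = l • w + π • g) ∨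
      ∀ y, ∃ (l : R) (g : A), (w - α • 1) * y = l • (w - α • 1) + π • g := by
  obtain ⟨g₀, hg₀⟩ := hw
  by_cases hw' : ∃ g : A, w - α • 1 = π • g
  · obtain ⟨g, hg⟩ := hw'
    exact Or.inr fun y => ⟨0, g * y, by rw [hg]; simp⟩
  have hle : S ≤ Subalgebra.rightIdealAdd w π := by
    intro t ht
    obtain ⟨r, s, g, rfl⟩ := hSw t ht
    exact ⟨r, s • 1, g, by simp⟩
  have hww : (w - α • 1) * w = π • g₀ := by
    rw [sub_mul, hg₀]
    simp
  -- If `R + wA + πA` is everything, write `y = r + wh + πg`; multiplying by `w - α` kills the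
  -- middle term modulo `π`. Otherwise it equals `S`, so `wy` is `r + sw` modulo `π`, and
  -- multiplying by `w - α` shows that a unit `r` would put `w - α` in `πA`, the case settled above.
  rcases hS.le_iff.1 hle with h | h
  · refine Or.inr fun y => ?_
    obtain ⟨r, h', g, hy⟩ : y ∈ Subalgebra.rightIdealAdd w π := h ▸ Algebra.mem_top
    refine ⟨r, g₀ * h' + (w - α • 1) * g, ?_⟩
    rw [hy, mul_add, mul_add, ← mul_assoc, hww]
    simp only [mul_smul_comm, smul_mul_assoc, mul_one, smul_add]
    abel
  · refine Or.inl fun y => ?_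
    obtain ⟨r, s, g, hy⟩ := hSw (w * y) (h ▸ ⟨0, y, 0, by simp⟩)
    by_cases hr : IsUnit r
    · exfalso
      obtain ⟨r, rfl⟩ := hr
      refine hw' ⟨(↑r⁻¹ : R) • (g₀ * y - s • g₀ - (w - α • 1) * g), ?_⟩
      have e : (w - α • 1) * (w * y) = (w - α • 1) * ((r : R) • 1 + s • w + π • g) := by rw [hy]
      rw [← mul_assoc, hww, mul_add, mul_add, mul_smul_comm, mul_smul_comm, mul_smul_comm, hww,
        mul_one] at e
      have e2 : (r : R) • (w - α • 1) = π • (g₀ * y - s • g₀ - (w - α • 1) * g) := by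
        rw [smul_mul_assoc] at e
        rw [smul_sub π, smul_sub π, e, smul_comm π s]
        abel
      rw [smul_comm, ← e2, smul_smul, Units.inv_mul, one_smul]
    · have hr' : r ∈ IsLocalRing.maximalIdeal R := hr
      rw [hπ, Ideal.mem_span_singleton] at hr'
      obtain ⟨r', rfl⟩ := hr'
      exact ⟨s, r' • 1 + g, by rw [hy]; module⟩

end Coatoms

/-! ### Pure quaternions and one-dimensional right ideals -/

section QuaternionSuborders

variable {R : Type*} [CommRing R]

/-- If the real part were nonzero, the scalar square of `p` would kill its imaginary part. Then `p`
is a nonzero scalar, and anticommuting with `q` forces `q = 0`, against `q² = -b' ≠ 0`. -/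
theorem QuaternionAlgebra.re_eq_zero_of_anticommute [IsDomain R] (h2 : (2 : R) ≠ 0) {a b a' b' : R}
    (hb' : b' ≠ 0) {p q : ℍ[R,-a,-b]}
    (hp : p * p = algebraMap R _ (-a')) (hq : q * q = algebraMap R _ (-b'))
    (hpq : p * q = -(q * p)) : p.re = 0 := by
  by_contra h0
  have key : ∀ t : R, 2 * p.re * t = 0 → t = 0 := fun t ht =>
    (mul_eq_zero.1 ht).resolve_left (mul_ne_zero h2 h0)
  have hI := congrArg QuaternionAlgebra.imI hp
  have hJ := congrArg QuaternionAlgebra.imJ hp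
  have hK := congrArg QuaternionAlgebra.imK hp
  simp at hI hJ hK
  have hI : p.imI = 0 := key _ (by linear_combination hI)
  have hJ : p.imJ = 0 := key _ (by linear_combination hJ)
  have hK : p.imK = 0 := key _ (by linear_combination hK)
  have h1 := congrArg QuaternionAlgebra.re hpq
  have h2 := congrArg QuaternionAlgebra.imI hpq
  have h3 := congrArg QuaternionAlgebra.imJ hpq
  have h4 := congrArg QuaternionAlgebra.imK hpq
  simp [hI, hJ, hK] at h1 h2 h3 h4
  have h1 : q.re = 0 := key q.re (by linear_combination h1)
  have h2 : q.imI = 0 := key q.imI (by linear_combination h2)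
  have h3 : q.imJ = 0 := key q.imJ (by linear_combination h3)
  have h4 : q.imK = 0 := key q.imK (by linear_combination h4)
  have h5 := congrArg QuaternionAlgebra.re hq
  simp [h1, h2, h3, h4] at h5
  exact hb' h5

/-- If `p` and `q` are pure quaternions then `w = c + p` spanning a right ideal of dimension at
most one modulo `π` forces strong congruences. -/
theorem QuaternionAlgebra.dvd_of_right_eigenvector {π : R} (hπ : Prime π) (h2 : ¬ π ∣ 2)
    {a b c x y z : R} (hprim : ¬ (π ∣ x ∧ π ∣ y ∧ π ∣ z))
    (h : ∀ t : ℍ[R,-a,-b], ∃ (l : R) (g : ℍ[R,-a,-b]),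
      (⟨c, x, y, z⟩ : ℍ[R,-a,-b]) * t = l • ⟨c, x, y, z⟩ + π • g) :
    π ∣ a * b ∧ (π ∣ b → π ∣ c ∧ π ∣ x) ∧ (π ∣ a → π ∣ c ∧ π ∣ y) ∧
      (c = 0 → π ∣ y ^ 2 + a * z ^ 2) := by
  have hW : ∀ l : R, (π ∣ l * x) → (π ∣ l * y) → (π ∣ l * z) → π ∣ l := by
    intro l h1 h2 h3
    by_contra hl
    exact hprim ⟨(hπ.dvd_or_dvd h1).resolve_left hl, (hπ.dvd_or_dvd h2).resolve_left hl,
      (hπ.dvd_or_dvd h3).resolve_left hl⟩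
  obtain ⟨l, g, hi⟩ := h ⟨0, 1, 0, 0⟩
  obtain ⟨m, g', hj⟩ := h ⟨0, 0, 1, 0⟩
  have i0 := congrArg QuaternionAlgebra.re hi
  have i1 := congrArg QuaternionAlgebra.imI hi
  have i2 := congrArg QuaternionAlgebra.imJ hi
  have i3 := congrArg QuaternionAlgebra.imK hi
  have j0 := congrArg QuaternionAlgebra.re hj
  have j1 := congrArg QuaternionAlgebra.imI hj
  have j2 := congrArg QuaternionAlgebra.imJ hj
  have j3 := congrArg QuaternionAlgebra.imK hj
  simp at i0 i1 i2 i3 j0 j1 j2 j3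
  -- Modulo `π`, right multiplication by `i` and `j` acts on the nonzero quaternion `c + p` by
  -- scalars `l` and `m`. The relations `i² = -a`, `j² = -b`, `ij = -ji` become `l² ≡ -a`, `m² ≡
  -- -b`, `2lm ≡ 0`.
  have hl : π ∣ l ^ 2 + a := by
    refine hW _ ⟨-(l * g.imI) - g.re, ?_⟩ ⟨-(l * g.imJ) - a * g.imK, ?_⟩
      ⟨-(l * g.imK) + g.imJ, ?_⟩
    · linear_combination (-l) * i1 - i0
    · linear_combination (-l) * i2 - a * i3
    · linear_combination (-l) * i3 + i2
  have hm : π ∣ m ^ 2 + b := by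
    refine hW _ ⟨-(m * g'.imI) + b * g'.imK, ?_⟩ ⟨-(m * g'.imJ) - g'.re, ?_⟩
      ⟨-(m * g'.imK) - g'.imI, ?_⟩
    · linear_combination (-m) * j1 + b * j3
    · linear_combination (-m) * j2 - j0
    · linear_combination (-m) * j3 - j1
  have hlm : π ∣ l * m := by
    refine (hπ.dvd_or_dvd (hW (2 * (l * m)) ⟨-(m * g.imI) - g'.re - l * g'.imI + b * g.imK, ?_⟩
      ⟨-(m * g.imJ) - a * g'.imK - l * g'.imJ - g.re, ?_⟩
      ⟨-(m * g.imK) + g'.imJ - l * g'.imK - g.imI, ?_⟩)).resolve_left h2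
    · linear_combination (-m) * i1 - j0 - l * j1 + b * i3
    · linear_combination (-m) * i2 - a * j3 - l * j2 - i0
    · linear_combination (-m) * i3 + j2 - l * j3 - i1
  refine ⟨?_, fun hb => ?_, fun ha => ?_, ?_⟩
  · have h1 := (hlm.mul_left (l * m)).sub ((hl.mul_right (m ^ 2)).sub (hm.mul_left a))
    have e : l * m * (l * m) - ((l ^ 2 + a) * m ^ 2 - a * (m ^ 2 + b)) = a * b := by ring
    rwa [e] at h1
  · have hm' : π ∣ m := hπ.dvd_of_dvd_pow ((dvd_add_left hb).1 hm)
    rw [j2, j3]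
    exact ⟨(hm'.mul_right _).add (dvd_mul_right _ _), (hm'.mul_right _).add (dvd_mul_right _ _)⟩
  · have hl' : π ∣ l := hπ.dvd_of_dvd_pow ((dvd_add_left ha).1 hl)
    rw [i1, ← dvd_neg (b := y), i3]
    exact ⟨(hl'.mul_right _).add (dvd_mul_right _ _), (hl'.mul_right _).add (dvd_mul_right _ _)⟩
  · rintro -
    have h1 := (hl.mul_right (z ^ 2))
    obtain ⟨k, hk⟩ := h1
    refine ⟨k + g.imK * (l * z - y), ?_⟩
    linear_combination hk + (l * z - y) * i3

end QuaternionSuborders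

/-! ### Coordinates of a maximal suborder -/

section QuaternionCoatoms

variable {R : Type*} [CommRing R]

/-- The congruences modulo `π` between the coefficients and the pure quaternion `x i + y j + z k`
forced by a one-dimensional right ideal generated by `± c + x i + y j + z k`. -/
def EigenCongruences (π a b c x y z : R) : Prop :=
  π ∣ a * b ∧ (π ∣ b → π ∣ c ∧ π ∣ x) ∧ (π ∣ a → π ∣ c ∧ π ∣ y) ∧
    (c = 0 → π ∣ y ^ 2 + a * z ^ 2)

/-- The coordinates, in a quaternion order `ℍ[R,-a,-b]`, of the standard generators of a maximal
suborder isomorphic to `ℍ[R,-a',-b']`, and the determinant `D` of that suborder. -/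
structure SuborderCoords (π a b a' b' : R) where
  (x y z u v w D : R)
  norm₁ : a * x ^ 2 + b * y ^ 2 + a * b * z ^ 2 = a'
  norm₂ : a * u ^ 2 + b * v ^ 2 + a * b * w ^ 2 = b'
  orth : a * (x * u) + b * (y * v) + a * b * (z * w) = 0
  disc : a * b * D = a' * b'
  index : Associated D π ∨
    Associated D (π ^ 2) ∧ ∀ c, π ∣ a' + c ^ 2 → EigenCongruences π a b c x y z

theorem QuaternionAlgebra.eq_top_of_mem {a b : R} {S : Subalgebra R ℍ[R,-a,-b]}
    (hi : (⟨0, 1, 0, 0⟩ : ℍ[R,-a,-b]) ∈ S) (hj : (⟨0, 0, 1, 0⟩ : ℍ[R,-a,-b]) ∈ S) : S = ⊤ := by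
  refine top_le_iff.1 fun t _ => ?_
  have e : t = algebraMap R _ t.re + t.imI • (⟨0, 1, 0, 0⟩ : ℍ[R,-a,-b]) +
      t.imJ • (⟨0, 0, 1, 0⟩ : ℍ[R,-a,-b]) +
      t.imK • ((⟨0, 1, 0, 0⟩ : ℍ[R,-a,-b]) * ⟨0, 0, 1, 0⟩) := by
    ext <;> simp
  rw [e]
  exact add_mem (add_mem (add_mem (S.algebraMap_mem _) (S.smul_mem hi _)) (S.smul_mem hj _))
    (S.smul_mem (mul_mem hi hj) _)

/-- Over the residue field, a vector whose cross product with a nonzero vector vanishes is a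
multiple of it; the factor is read off at a unit coordinate. -/
theorem exists_dvd_sub_smul_of_dvd_cross [IsDomain R] [IsLocalRing R] {π : R}
    (hmax : IsLocalRing.maximalIdeal R = Ideal.span {π}) {x y z u v w : R}
    (hprim : ¬ (π ∣ x ∧ π ∣ y ∧ π ∣ z))
    (h1 : π ∣ y * w - z * v) (h2 : π ∣ z * u - x * w) (h3 : π ∣ x * v - y * u) :
    ∃ β, π ∣ u - β * x ∧ π ∣ v - β * y ∧ π ∣ w - β * z := by
  have hu : ∀ t : R, ¬ π ∣ t → ∃ t', t * t' = 1 := by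
    intro t ht
    have : t ∉ IsLocalRing.maximalIdeal R := by rwa [hmax, Ideal.mem_span_singleton]
    exact (IsLocalRing.notMem_maximalIdeal.1 this).exists_right_inv
  by_cases hx : π ∣ x
  · by_cases hy : π ∣ y
    · by_cases hz : π ∣ z
      · exact absurd ⟨hx, hy, hz⟩ hprim
      · obtain ⟨t, ht⟩ := hu z hz
        refine ⟨w * t, ?_, ?_, ?_⟩
        · convert h2.mul_left t using 1; linear_combination (-u) * ht
        · convert h1.mul_left (-t) using 1; linear_combination (-v) * ht
        · convert dvd_zero π using 1; linear_combination (-w) * ht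
    · obtain ⟨t, ht⟩ := hu y hy
      refine ⟨v * t, ?_, ?_, ?_⟩
      · convert h3.mul_left (-t) using 1; linear_combination (-u) * ht
      · convert dvd_zero π using 1; linear_combination (-v) * ht
      · convert h1.mul_left t using 1; linear_combination (-w) * ht
  · obtain ⟨t, ht⟩ := hu x hx
    refine ⟨u * t, ?_, ?_, ?_⟩
    · convert dvd_zero π using 1; linear_combination (-u) * ht
    · convert h3.mul_left t using 1; linear_combination (-v) * ht
    · convert h2.mul_left (-t) using 1; linear_combination (-w) * ht

/-- The coordinates are those of the images `p`, `q` of `i`, `j`. Since `π²` does not divide `a'`,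
the vector `p` is nonzero modulo `π`, which the congruences in index `π²` require. -/
theorem SuborderCoords.nonempty [IsDomain R] [IsLocalRing R] {π : R} (hπ : Prime π)
    (hmax : IsLocalRing.maximalIdeal R = Ideal.span {π}) (h2 : ¬ π ∣ 2) {a b a' b' : R}
    (ha' : a' ≠ 0) (hb' : b' ≠ 0) (ha'2 : ¬ π ^ 2 ∣ a')
    {S : Subalgebra R ℍ[R,-a,-b]} (hS : IsCoatom S) (f : ℍ[R,-a',-b'] ≃ₐ[R] S) :
    Nonempty (SuborderCoords π a b a' b') := by
  have h20 : (2 : R) ≠ 0 := fun h => h2 (h ▸ dvd_zero π)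
  have hfin : Module.Finite R ℍ[R,-a,-b] :=
    Module.Finite.of_basis (QuaternionAlgebra.basisOneIJK _ _ _)
  have hπS : ∀ g, π • g ∈ S := hS.smul_mem_of_mem_maximalIdeal (by
    rw [hmax]; exact Ideal.mem_span_singleton_self π)
  set F : ℍ[R,-a',-b'] →ₐ[R] ℍ[R,-a,-b] := S.val.comp f.toAlgHom with hF
  have hFS : ∀ t, F t ∈ S := fun t => (f t).2
  have hFsurj : ∀ s ∈ S, ∃ t, F t = s := fun s hs => ⟨f.symm ⟨s, hs⟩, by simp [hF]⟩
  set p := F ⟨0, 1, 0, 0⟩ with hp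
  set q := F ⟨0, 0, 1, 0⟩ with hq
  have hpS : p ∈ S := hFS _
  have hqS : q ∈ S := hFS _
  have hpp : p * p = algebraMap R _ (-a') := by
    rw [hp, ← map_mul, ← F.commutes]; congr 1; ext <;> simp
  have hqq : q * q = algebraMap R _ (-b') := by
    rw [hq, ← map_mul, ← F.commutes]; congr 1; ext <;> simp
  have hpq : p * q = -(q * p) := by
    rw [hp, hq, ← map_mul, ← map_mul, ← map_neg]; congr 1; ext <;> simp
  have hspan : ∀ s ∈ S, ∃ r k l m : R, s = r • 1 + k • p + l • q + m • (p * q) := by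
    intro s hs
    obtain ⟨t, rfl⟩ := hFsurj s hs
    refine ⟨t.re, t.imI, t.imJ, t.imK, ?_⟩
    rw [hp, hq, ← map_mul, ← map_one F, ← map_smul, ← map_smul, ← map_smul, ← map_smul,
      ← map_add, ← map_add, ← map_add]
    congr 1
    ext <;> simp
  clear_value p q
  have hp0 : p.re = 0 := QuaternionAlgebra.re_eq_zero_of_anticommute h20 hb' hpp hqq hpq
  have hq0 : q.re = 0 := QuaternionAlgebra.re_eq_zero_of_anticommute h20 ha' hqq hpp
    (by rw [hpq, neg_neg])
  obtain ⟨p0, x, y, z⟩ := p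
  obtain ⟨q0, u, v, w⟩ := q
  obtain rfl : p0 = 0 := hp0
  obtain rfl : q0 = 0 := hq0
  have n1 := congrArg QuaternionAlgebra.re hpp
  have n2 := congrArg QuaternionAlgebra.re hqq
  have o := congrArg QuaternionAlgebra.re hpq
  simp at n1 n2 o
  have n1 : a * x ^ 2 + b * y ^ 2 + a * b * z ^ 2 = a' := by linear_combination -n1
  have n2 : a * u ^ 2 + b * v ^ 2 + a * b * w ^ 2 = b' := by linear_combination -n2
  have o : a * (x * u) + b * (y * v) + a * b * (z * w) = 0 := by
    refine (mul_eq_zero.1 (?_ : (2 : R) * _ = 0)).resolve_left h20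
    linear_combination -o
  have hpqc : (⟨0, x, y, z⟩ : ℍ[R,-a,-b]) * ⟨0, u, v, w⟩ =
      ⟨0, b * (y * w - z * v), a * (z * u - x * w), x * v - y * u⟩ := by
    ext
    · simp; linear_combination -o
    · simp; ring
    · simp; ring
    · simp
  rw [hpqc] at hspan
  have hrS : (⟨0, b * (y * w - z * v), a * (z * u - x * w), x * v - y * u⟩ : ℍ[R,-a,-b]) ∈ S :=
    hpqc ▸ mul_mem hpS hqS
  obtain ⟨m₁, hm₁⟩ : ∃ m₁, m₁ = y * w - z * v := ⟨_, rfl⟩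
  obtain ⟨m₂, hm₂⟩ : ∃ m₂, m₂ = z * u - x * w := ⟨_, rfl⟩
  obtain ⟨m₃, hm₃⟩ : ∃ m₃, m₃ = x * v - y * u := ⟨_, rfl⟩
  rw [← hm₁, ← hm₂, ← hm₃] at hspan hrS
  -- `D` is the determinant of `p, q, pq` in the basis `i, j, k`, and `abD` is the norm of `pq`.
  obtain ⟨D, hD⟩ : ∃ D, D = b * m₁ ^ 2 + a * m₂ ^ 2 + m₃ ^ 2 := ⟨_, rfl⟩
  have hdisc : a * b * D = a' * b' := by
    rw [← n1, ← n2, hD, hm₁, hm₂, hm₃]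
    linear_combination (-(a * (x * u) + b * (y * v) + a * b * (z * w))) * o
  have hD0 : D ≠ 0 := by
    rintro rfl
    rw [mul_zero] at hdisc
    exact mul_ne_zero ha' hb' hdisc.symm
  -- Cramer's rule: a unit determinant would put `i` and `j` in `S`.
  have hDu : ¬ IsUnit D := by
    intro hu
    obtain ⟨D', hD'⟩ := hu.exists_right_inv
    refine hS.1 (QuaternionAlgebra.eq_top_of_mem ?_ ?_)
    · have e : (⟨0, 1, 0, 0⟩ : ℍ[R,-a,-b]) = D' • ((v * m₃ - w * (a * m₂)) • ⟨0, x, y, z⟩ +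
          (z * (a * m₂) - y * m₃) • ⟨0, u, v, w⟩ + m₁ • ⟨0, b * m₁, a * m₂, m₃⟩) := by
        ext
        · simp
        · simp; rw [← hD', hD, hm₁, hm₂, hm₃]; ring
        · simp; rw [hm₁, hm₂, hm₃]; ring_nf; tauto
        · simp; rw [hm₁, hm₂, hm₃]; ring_nf; tauto
      rw [e]
      exact S.smul_mem (add_mem (add_mem (S.smul_mem hpS _) (S.smul_mem hqS _)) (S.smul_mem hrS _)) _
    · have e : (⟨0, 0, 1, 0⟩ : ℍ[R,-a,-b]) = D' • ((w * (b * m₁) - u * m₃) • ⟨0, x, y, z⟩ +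
          (x * m₃ - z * (b * m₁)) • ⟨0, u, v, w⟩ + m₂ • ⟨0, b * m₁, a * m₂, m₃⟩) := by
        ext
        · simp
        · simp; rw [hm₁, hm₂, hm₃]; ring_nf; tauto
        · simp; rw [← hD', hD, hm₁, hm₂, hm₃]; ring
        · simp; rw [hm₁, hm₂, hm₃]; ring_nf; tauto
      rw [e]
      exact S.smul_mem (add_mem (add_mem (S.smul_mem hpS _) (S.smul_mem hqS _)) (S.smul_mem hrS _)) _
  -- The cross product `(m₁, m₂, m₃)` is orthogonal to `p` and `q` and pairs with `pq` to `D`.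
  -- Pairing it with `πg ∈ S` therefore leaves the coefficient of `pq` times `D`.
  have hdual : ∀ g : ℍ[R,-a,-b], ∃ γ, π * (g.imI * m₁ + g.imJ * m₂ + g.imK * m₃) = γ * D := by
    intro g
    obtain ⟨r, k, l, m, e⟩ := hspan _ (hπS g)
    have e1 := congrArg QuaternionAlgebra.imI e
    have e2 := congrArg QuaternionAlgebra.imJ e
    have e3 := congrArg QuaternionAlgebra.imK e
    simp at e1 e2 e3
    refine ⟨m, ?_⟩
    rw [hD]
    linear_combination m₁ * e1 + m₂ * e2 + m₃ * e3 + (k * x + l * u) * hm₁ +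
      (k * y + l * v) * hm₂ + (k * z + l * w) * hm₃
  obtain ⟨γ₁, hγ₁⟩ := hdual ⟨0, 1, 0, 0⟩
  obtain ⟨γ₂, hγ₂⟩ := hdual ⟨0, 0, 1, 0⟩
  obtain ⟨γ₃, hγ₃⟩ := hdual ⟨0, 0, 0, 1⟩
  simp at hγ₁ hγ₂ hγ₃
  have hDdvd : D ∣ π ^ 2 := by
    refine ⟨b * γ₁ ^ 2 + a * γ₂ ^ 2 + γ₃ ^ 2, mul_left_cancel₀ hD0 ?_⟩
    linear_combination π ^ 2 * hD + b * (π * m₁ + γ₁ * D) * hγ₁ + a * (π * m₂ + γ₂ * D) * hγ₂ +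
      (π * m₃ + γ₃ * D) * hγ₃
  obtain ⟨i, hi2, hi⟩ := (dvd_prime_pow hπ 2).1 hDdvd
  refine ⟨⟨x, y, z, u, v, w, D, n1, n2, o, hdisc, ?_⟩⟩
  interval_cases i
  · exact absurd (associated_one_iff_isUnit.1 (by simpa using hi)) hDu
  · exact Or.inl (by simpa using hi)
  refine Or.inr ⟨hi, fun c hc => ?_⟩
  have hprim : ¬ (π ∣ x ∧ π ∣ y ∧ π ∣ z) := by
    rintro ⟨⟨x, rfl⟩, ⟨y, rfl⟩, ⟨z, rfl⟩⟩
    exact ha'2 ⟨a * x ^ 2 + b * y ^ 2 + a * b * z ^ 2, by rw [← n1]; ring⟩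
  -- When `D` is associated to `π²` the cross product vanishes modulo `π`. Hence `q ≡ βp` and `pq ≡
  -- 0`, so `S` modulo `π` is spanned by `1` and `p`.
  have hcross : ∀ m γ, π * m = γ * D → π ∣ m := by
    intro m γ h
    obtain ⟨e, he⟩ := hi.symm.dvd
    exact ⟨γ * e, mul_left_cancel₀ hπ.ne_zero (by rw [h, he]; ring)⟩
  have d1 := hcross _ _ hγ₁
  have d2 := hcross _ _ hγ₂
  have d3 := hcross _ _ hγ₃
  obtain ⟨β, ⟨u', hu'⟩, ⟨v', hv'⟩, ⟨w', hw'⟩⟩ := exists_dvd_sub_smul_of_dvd_cross hmax hprim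
    (hm₁ ▸ d1) (hm₂ ▸ d2) (hm₃ ▸ d3)
  obtain ⟨k₁, rfl⟩ := d1
  obtain ⟨k₂, rfl⟩ := d2
  obtain ⟨k₃, rfl⟩ := d3
  obtain ⟨n, hn⟩ := hc
  -- For `w = c + p` one has `w² = 2cw - (c² + a')`, so `α = 2c`. The alternative generator is `w -
  -- α = -c + p`, and the congruences do not see the sign of `c`.
  have hcases := hS.exists_right_eigenvector hmax (w := (⟨c, x, y, z⟩ : ℍ[R,-a,-b])) (α := 2 * c)
    ⟨⟨-n, 0, 0, 0⟩, by
      ext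
      · simp; linear_combination -n1 - hn
      · simp; ring
      · simp; ring
      · simp; ring⟩
    (by
      intro t ht
      obtain ⟨r, k, l, m, rfl⟩ := hspan t ht
      refine ⟨r - (k + l * β) * c, k + l * β, ⟨0, l * u' + m * (b * k₁), l * v' + m * (a * k₂),
        l * w' + m * k₃⟩, ?_⟩
      ext
      · simp
      · simp; linear_combination l * hu'
      · simp; linear_combination l * hv'
      · simp; linear_combination l * hw')
  rcases hcases with h | h
  · exact QuaternionAlgebra.dvd_of_right_eigenvector hπ h2 hprim h
  · have e : (⟨c, x, y, z⟩ : ℍ[R,-a,-b]) - (2 * c) • 1 = ⟨-c, x, y, z⟩ := by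
      ext
      · simp; ring
      · simp
      · simp
      · simp
    rw [e] at h
    have := QuaternionAlgebra.dvd_of_right_eigenvector hπ h2 hprim h
    simpa [EigenCongruences] using this

end QuaternionCoatoms

/-! ### Excluding pairs of forms by congruences -/

section Congruences

variable {R : Type*} [CommRing R] {π δ : R}

theorem eq_add_of_associated_pow [IsDomain R] (hπ : Prime π) {c c' D : R} {m n d : ℕ}
    (hc : ¬ π ∣ c) (hc' : ¬ π ∣ c') (h : c * π ^ m * D = c' * π ^ n) (hD : Associated D (π ^ d)) :
    n = m + d := by
  obtain ⟨e, rfl⟩ := hD.symm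
  have he : ¬ π ∣ (e : R) := fun h => hπ.not_isUnit (isUnit_of_dvd_unit h e.isUnit)
  have hce : ¬ π ∣ c * e := hπ.not_dvd_mul hc he
  have h' : π ^ (m + d) * (c * e) = π ^ n * c' := by rw [pow_add]; linear_combination h
  refine le_antisymm ?_ ?_
  · by_contra! hlt
    obtain ⟨k, rfl⟩ := Nat.exists_eq_add_of_lt hlt
    rw [add_assoc, pow_add π (m + d), mul_assoc] at h'
    refine hce ⟨π ^ k * c', ?_⟩
    rw [mul_left_cancel₀ (pow_ne_zero _ hπ.ne_zero) h']
    ring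
  · by_contra! hlt
    obtain ⟨k, hk⟩ := Nat.exists_eq_add_of_lt hlt
    rw [hk, add_assoc, pow_add π n, mul_assoc] at h'
    refine hc' ⟨π ^ k * (c * e), ?_⟩
    rw [← mul_left_cancel₀ (pow_ne_zero _ hπ.ne_zero) h']
    ring

/-- There is no maximal suborder of type `⟨1, -δ, π^(s+1)⟩` in `⟨1, -δ, π^s⟩`, `s ≥ 1`. -/
theorem SuborderCoords.false_of_unramified [IsDomain R] (hπ : Prime π)
    (hδ : ∀ x y : R, π ∣ x ^ 2 - δ * y ^ 2 → π ∣ x ∧ π ∣ y) (hδ' : ¬ π ∣ δ) (n : ℕ)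
    (C : SuborderCoords π (-δ) (π ^ (n + 1)) (-δ) (π ^ (n + 2))) : False := by
  obtain ⟨x, y, z, u, v, w, -, h1, h2, h3, -, -⟩ := C
  have hx : ¬ π ∣ δ * x := by
    rintro h
    obtain ⟨x, rfl⟩ := (hπ.dvd_or_dvd h).resolve_left hδ'
    exact hδ' ⟨δ * π * x ^ 2 - π ^ n * y ^ 2 + δ * π ^ n * z ^ 2, by linear_combination h1⟩
  obtain ⟨u, rfl⟩ : π ^ (n + 1) ∣ u := hπ.pow_dvd_of_dvd_mul_left _ hx
    ⟨y * v - δ * (z * w), by linear_combination -h3⟩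
  have h3' : -(δ * x * u) + y * v - δ * (z * w) = 0 :=
    mul_left_cancel₀ (pow_ne_zero (n + 1) hπ.ne_zero) (by linear_combination h3)
  have h2' : -(δ * π ^ (n + 1) * u ^ 2) + v ^ 2 - δ * w ^ 2 = π :=
    mul_left_cancel₀ (pow_ne_zero (n + 1) hπ.ne_zero) (by linear_combination h2)
  -- Anisotropy of `x² - δy²` modulo `π` makes `v` and `w`, and then `u`, divisible by `π`; the left
  -- side of `h2'` would be divisible by `π²` while the right side is `π`.
  obtain ⟨⟨v, rfl⟩, ⟨w, rfl⟩⟩ := hδ v w ⟨1 + δ * π ^ n * u ^ 2, by linear_combination h2'⟩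
  obtain ⟨u, rfl⟩ : π ∣ u := (hπ.dvd_or_dvd (show π ∣ δ * x * u from
    ⟨y * v - δ * (z * w), by linear_combination -h3'⟩)).resolve_left hx
  refine hπ.not_isUnit (IsUnit.of_mul_eq_one (-(δ * π ^ (n + 1) * u ^ 2) + v ^ 2 - δ * w ^ 2) ?_)
  exact mul_left_cancel₀ hπ.ne_zero (by linear_combination h2')

/-- There is no maximal suborder of type `⟨1, -δ, π⟩` in `⟨1, -1, 1⟩`. -/
theorem SuborderCoords.false_of_split [IsDomain R] (hπ : Prime π)
    (hδ : ∀ x y : R, π ∣ x ^ 2 - δ * y ^ 2 → π ∣ x ∧ π ∣ y) (hδ' : ¬ π ∣ δ)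
    (C : SuborderCoords π (-1) 1 (-δ) π) : False := by
  obtain ⟨x, y, z, u, v, w, -, h1, h2, h3, -, -⟩ := C
  have h1 : x ^ 2 - y ^ 2 + z ^ 2 = δ := by linear_combination -h1
  have h2 : v ^ 2 - u ^ 2 - w ^ 2 = π := by linear_combination h2
  have h3 : x * u + z * w = y * v := by linear_combination -h3
  have huvw : π ∣ u ∧ π ∣ w := by
    by_cases hy : π ∣ y
    · obtain ⟨hd, hv⟩ := hδ (x * w - z * u) v ⟨-(δ + y ^ 2), by
        linear_combination (u ^ 2 + w ^ 2) * h1 - (δ + y ^ 2) * h2 - (x * u + z * w + y * v) * h3⟩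
      have hu : δ * u = v * (x * y) - (x * w - z * u) * z - y * (y * u) := by
        linear_combination (-u) * h1 + x * h3
      have hw : δ * w = (x * w - z * u) * x + v * (z * y) - y * (y * w) := by
        linear_combination (-w) * h1 + z * h3
      refine ⟨(hπ.dvd_or_dvd (hu ▸ ?_)).resolve_left hδ', (hπ.dvd_or_dvd (hw ▸ ?_)).resolve_left hδ'⟩
      · exact ((hv.mul_right _).sub (hd.mul_right _)).sub (hy.mul_right _)
      · exact ((hd.mul_right _).add (hv.mul_right _)).sub (hy.mul_right _)
    -- Eliminating `v` leaves a binary form in `u, w` whose quarter discriminant is `y²(x² - y² +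
    -- z²) = δy²`. Completing the square in either variable gives a value of the anisotropic form.
    · have hw := (hδ ((x ^ 2 - y ^ 2) * u + x * z * w) (y * w) ⟨(x ^ 2 - y ^ 2) * y ^ 2, by
        rw [← h1]
        linear_combination (x ^ 2 - y ^ 2) * y ^ 2 * h2 + (x ^ 2 - y ^ 2) * (x * u + z * w + y * v) * h3⟩).2
      have hu := (hδ ((z ^ 2 - y ^ 2) * w + x * z * u) (y * u) ⟨(z ^ 2 - y ^ 2) * y ^ 2, by
        rw [← h1]
        linear_combination (z ^ 2 - y ^ 2) * y ^ 2 * h2 + (z ^ 2 - y ^ 2) * (x * u + z * w + y * v) * h3⟩).2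
      exact ⟨(hπ.dvd_or_dvd hu).resolve_left hy, (hπ.dvd_or_dvd hw).resolve_left hy⟩
  obtain ⟨⟨u, rfl⟩, ⟨w, rfl⟩⟩ := huvw
  obtain ⟨v, rfl⟩ : π ∣ v := hπ.dvd_of_dvd_pow (n := 2)
    ⟨1 + π * u ^ 2 + π * w ^ 2, by linear_combination h2⟩
  refine hπ.not_isUnit (IsUnit.of_mul_eq_one (v ^ 2 - u ^ 2 - w ^ 2) ?_)
  exact mul_left_cancel₀ hπ.ne_zero (by linear_combination h2)

/-- A maximal suborder of type `⟨1, π, επ⟩` in `⟨1, -η, π⟩` forces `-ηε` to be a square. -/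
theorem SuborderCoords.exists_dvd_add_of_ramified [IsDomain R] (hπ : Prime π) {η ε : R}
    (hη : ¬ π ∣ η) (C : SuborderCoords π (-η) π π (ε * π)) : ∃ m, π ∣ ε + η * m ^ 2 := by
  obtain ⟨x, y, z, u, v, w, -, h1, h2, h3, -, -⟩ := C
  have hdiv : ∀ x : R, π ∣ η * x ^ 2 → π ∣ x := fun x h =>
    hπ.dvd_of_dvd_pow ((hπ.dvd_or_dvd h).resolve_left hη)
  obtain ⟨x, rfl⟩ := hdiv x ⟨y ^ 2 - η * z ^ 2 - 1, by linear_combination -h1⟩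
  obtain ⟨u, rfl⟩ := hdiv u ⟨v ^ 2 - η * w ^ 2 - ε, by linear_combination -h2⟩
  have h1 : y ^ 2 - η * z ^ 2 = 1 + η * π * x ^ 2 :=
    mul_left_cancel₀ hπ.ne_zero (by linear_combination h1)
  have h2 : v ^ 2 - η * w ^ 2 = ε + η * π * u ^ 2 :=
    mul_left_cancel₀ hπ.ne_zero (by linear_combination h2)
  have h3 : y * v - η * (z * w) = η * π * x * u :=
    mul_left_cancel₀ hπ.ne_zero (by linear_combination h3)
  -- Composition: `(y² - ηz²)(v² - ηw²) = (yv - ηzw)² - η(yw - zv)²`, where modulo `π` the factors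
  -- are `1` and `ε` and `yv - ηzw` vanishes.
  refine ⟨y * w - z * v, η ^ 2 * π * x ^ 2 * u ^ 2 - η * u ^ 2 - η * x ^ 2 * (ε + η * π * u ^ 2), ?_⟩
  linear_combination (v ^ 2 - η * w ^ 2) * (-h1) - (1 + η * π * x ^ 2) * h2 +
    (y * v - η * (z * w) + η * π * x * u) * h3

/-- The first norm equation forces `π ∣ x`, so `π^s (y² - ηz²)` must account for the single factor
`π` of `a'`. Either alternative in the last hypothesis makes it divisible by `π²`. -/
theorem SuborderCoords.false_of_unit_ramified (hπ : Prime π) {η a' b' : R} {s : ℕ} (hs : s ≠ 0)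
    (hη : ¬ π ∣ η) (hη' : π ∣ a') (ha' : ¬ π ^ 2 ∣ a')
    (C : SuborderCoords π (-η) (π ^ s) a' b') (h : 2 ≤ s ∨ π ∣ C.y ^ 2 + -η * C.z ^ 2) : False := by
  revert h
  obtain ⟨x, y, z, u, v, w, D, h1, h2, h3, -, h4⟩ := C
  intro h
  dsimp only at h
  obtain ⟨n, rfl⟩ := Nat.exists_eq_succ_of_ne_zero hs
  obtain ⟨c, rfl⟩ := hη'
  obtain ⟨x, rfl⟩ : π ∣ x := hπ.dvd_of_dvd_pow ((hπ.dvd_or_dvd (show π ∣ η * x ^ 2 from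
    ⟨π ^ n * y ^ 2 - η * π ^ n * z ^ 2 - c, by
      simp only [Nat.succ_eq_add_one] at h1; linear_combination -h1⟩)).resolve_left hη)
  rcases h with h | ⟨k, hk⟩
  · obtain ⟨m, rfl⟩ : ∃ m, n = m + 1 := ⟨n - 1, by omega⟩
    exact ha' ⟨-(η * x ^ 2) + π ^ m * y ^ 2 - η * π ^ m * z ^ 2, by
      simp only [Nat.succ_eq_add_one] at h1; linear_combination -h1⟩
  · exact ha' ⟨-(η * x ^ 2) + π ^ n * k, by
      simp only [Nat.succ_eq_add_one] at h1; linear_combination -h1 + π ^ (n + 1) * hk⟩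

/-- A maximal suborder of `⟨1, ε₁π, ε₂π^s⟩` of type `⟨1, ε₁'π, ε₂'π^(s+1)⟩` has
`ε₂' ≡ ε₁ε₂` up to squares, and also `ε₁' ≡ ε₁` up to squares if `s ≥ 2`. -/
theorem SuborderCoords.exists_dvd_sub [IsDomain R] (hπ : Prime π) {ε₁ ε₂ ε₁' ε₂' : R} {s : ℕ}
    (hs : s ≠ 0) (hs1 : s = 1 → ε₁ = 1) (hε₁ : ¬ π ∣ ε₁) (hε₂ : ¬ π ∣ ε₂) (hε₁' : ¬ π ∣ ε₁')
    (C : SuborderCoords π (ε₁ * π) (ε₂ * π ^ s) (ε₁' * π) (ε₂' * π ^ (s + 1))) :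
    (2 ≤ s → ∃ m, π ∣ ε₁' - ε₁ * m ^ 2) ∧ ∃ m, π ∣ ε₂' - ε₁ * ε₂ * m ^ 2 := by
  obtain ⟨x, y, z, u, v, w, -, h1, h2, h3, -, -⟩ := C
  obtain ⟨n, rfl⟩ := Nat.exists_eq_succ_of_ne_zero hs
  simp only [Nat.succ_eq_add_one] at h1 h2 h3
  have h1 : ε₁ * x ^ 2 + ε₂ * π ^ n * y ^ 2 + ε₁ * ε₂ * π ^ (n + 1) * z ^ 2 = ε₁' :=
    mul_left_cancel₀ hπ.ne_zero (by linear_combination h1)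
  have h2 : ε₁ * u ^ 2 + ε₂ * π ^ n * v ^ 2 + ε₁ * ε₂ * π ^ (n + 1) * w ^ 2 = ε₂' * π ^ (n + 1) :=
    mul_left_cancel₀ hπ.ne_zero (by linear_combination h2)
  have h3 : ε₁ * x * u + ε₂ * π ^ n * (y * v) + ε₁ * ε₂ * π ^ (n + 1) * (z * w) = 0 :=
    mul_left_cancel₀ hπ.ne_zero (by linear_combination h3)
  rcases n with _ | n
  · obtain rfl := hs1 rfl
    simp only [pow_zero, zero_add, pow_one, one_mul, mul_one] at h1 h2 h3
    refine ⟨by simp, w, ?_⟩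
    have hN : ¬ π ∣ x ^ 2 + ε₂ * y ^ 2 := fun ⟨k, hk⟩ => hε₁' ⟨k + ε₂ * z ^ 2, by
      linear_combination -h1 + hk⟩
    have hd : π ∣ x * u + ε₂ * (y * v) := ⟨-(ε₂ * (z * w)), by linear_combination h3⟩
    -- Composition for `x² + ε₂y²`: the value at `(u, v)` is divisible by `π` and so is the polar
    -- term, hence so is the square of the cross term.
    have hc : π ∣ x * v - y * u := by
      refine hπ.dvd_of_dvd_pow (n := 2) ((hπ.dvd_or_dvd (?_ : π ∣ ε₂ * _)).resolve_left hε₂)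
      have e : ε₂ * (x * v - y * u) ^ 2 = π * ((x ^ 2 + ε₂ * y ^ 2) * (ε₂' - ε₂ * w ^ 2)) -
          (x * u + ε₂ * (y * v)) * (x * u + ε₂ * (y * v)) := by
        linear_combination (x ^ 2 + ε₂ * y ^ 2) * h2
      rw [e]
      exact (dvd_mul_right _ _).sub (hd.mul_right _)
    obtain ⟨u, rfl⟩ : π ∣ u := by
      refine (hπ.dvd_or_dvd (?_ : π ∣ (x ^ 2 + ε₂ * y ^ 2) * u)).resolve_left hN
      convert (hd.mul_right x).sub (hc.mul_right (ε₂ * y)) using 1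
      ring
    obtain ⟨v, rfl⟩ : π ∣ v := by
      refine (hπ.dvd_or_dvd (?_ : π ∣ (x ^ 2 + ε₂ * y ^ 2) * v)).resolve_left hN
      convert (hd.mul_right y).add (hc.mul_right x) using 1
      ring
    refine ⟨u ^ 2 + ε₂ * v ^ 2, mul_left_cancel₀ hπ.ne_zero ?_⟩
    linear_combination -h2
  · refine ⟨fun _ => ⟨x, ε₂ * π ^ n * y ^ 2 + ε₁ * ε₂ * π ^ (n + 1) * z ^ 2, ?_⟩, w, ?_⟩
    · linear_combination -h1
    have hx : ¬ π ∣ ε₁ * x := by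
      intro h
      obtain ⟨x, rfl⟩ := (hπ.dvd_or_dvd h).resolve_left hε₁
      exact hε₁' ⟨ε₁ * π * x ^ 2 + ε₂ * π ^ n * y ^ 2 + ε₁ * ε₂ * π ^ (n + 1) * z ^ 2, by
        linear_combination -h1⟩
    obtain ⟨u, rfl⟩ : π ^ (n + 1) ∣ u := hπ.pow_dvd_of_dvd_mul_left _ hx
      ⟨-(ε₂ * (y * v)) - ε₁ * ε₂ * π * (z * w), by linear_combination h3⟩
    have h2 : ε₁ * π ^ (n + 1) * u ^ 2 + ε₂ * v ^ 2 + ε₁ * ε₂ * π * w ^ 2 = ε₂' * π :=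
      mul_left_cancel₀ (pow_ne_zero (n + 1) hπ.ne_zero) (by linear_combination h2)
    have h3 : ε₁ * x * u + ε₂ * (y * v) + ε₁ * ε₂ * π * (z * w) = 0 :=
      mul_left_cancel₀ (pow_ne_zero (n + 1) hπ.ne_zero) (by linear_combination h3)
    obtain ⟨v, rfl⟩ : π ∣ v := hπ.dvd_of_dvd_pow ((hπ.dvd_or_dvd (show π ∣ ε₂ * v ^ 2 from
      ⟨ε₂' - ε₁ * π ^ n * u ^ 2 - ε₁ * ε₂ * w ^ 2, by linear_combination h2⟩)).resolve_left hε₂)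
    obtain ⟨u, rfl⟩ : π ∣ u := (hπ.dvd_or_dvd (show π ∣ ε₁ * x * u from
      ⟨-(ε₂ * (y * v)) - ε₁ * ε₂ * (z * w), by linear_combination h3⟩)).resolve_left hx
    refine ⟨ε₁ * π ^ (n + 1) * u ^ 2 + ε₂ * v ^ 2, mul_left_cancel₀ hπ.ne_zero ?_⟩
    linear_combination -h2

/-- As `π ∣ a'`, the value `c = 0` is admissible; the congruences give `π ∣ x` and `π ∣ y`, and the
norm equation then makes `a'` divisible by `π²`. -/
theorem SuborderCoords.false_of_nilpotent {ε₁ ε₂ a' b' : R} {s : ℕ} (hs : s ≠ 0)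
    (hε' : π ∣ a') (ha' : ¬ π ^ 2 ∣ a')
    (C : SuborderCoords π (ε₁ * π) (ε₂ * π ^ s) a' b') (h : ∀ c, π ∣ a' + c ^ 2 →
      EigenCongruences π (ε₁ * π) (ε₂ * π ^ s) c C.x C.y C.z) : False := by
  revert h
  obtain ⟨x, y, z, u, v, w, D, h1, h2, h3, -, -⟩ := C
  intro h
  obtain ⟨n, rfl⟩ := Nat.exists_eq_succ_of_ne_zero hs
  dsimp only at h
  obtain ⟨-, hx, hy, -⟩ := h 0 (by simpa using hε')
  obtain ⟨-, x, rfl⟩ := hx ⟨ε₂ * π ^ n, by rw [pow_succ]; ring⟩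
  obtain ⟨-, y, rfl⟩ := hy ⟨ε₁, by ring⟩
  exact ha' ⟨ε₁ * π * x ^ 2 + ε₂ * π ^ (n + 1) * y ^ 2 + ε₁ * ε₂ * π ^ n * z ^ 2, by
    simp only [Nat.succ_eq_add_one] at h1; linear_combination -h1⟩

end Congruences

/-! ### Hensel's lemma and the auxiliary elements -/

section SquareRoots

open IsLocalRing

variable {R : Type*} [CommRing R] [IsLocalRing R]

/-- In a complete local ring in which `2` is invertible, units which are squares in the residue
field are squares. -/
theorem exists_sq_eq_of_isSquare_residue [IsAdicComplete (maximalIdeal R) R] (h2 : IsUnit (2 : R))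
    {c : R} (hc : residue R c ≠ 0) (h : IsSquare (residue R c)) : ∃ x : R, x ^ 2 = c := by
  obtain ⟨y, hy⟩ := h
  obtain ⟨y, rfl⟩ := residue_surjective y
  have hyu : IsUnit y := by
    by_contra hn
    exact hc (by rw [hy, (residue_eq_zero_iff y).2 hn, mul_zero])
  obtain ⟨x, hx, -⟩ := HenselianRing.is_henselian (I := maximalIdeal R)
    (Polynomial.X ^ 2 - Polynomial.C c) (Polynomial.monic_X_pow_sub_C c two_ne_zero) y
    (by
      rw [← residue_eq_zero_iff]
      simp [hy, sq])
    (by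
      refine IsUnit.map _ ?_
      simpa [Polynomial.derivative_sub, one_add_one_eq_two] using And.intro h2 hyu)
  exact ⟨x, by simpa [sub_eq_zero] using hx⟩

variable [Finite (ResidueField R)]

/-- In a finite field the product of the nonsquares `-1` and `δ` is a square. -/
theorem exists_sq_eq_neg_of_not_isSquare [IsAdicComplete (maximalIdeal R) R] (h2 : IsUnit (2 : R))
    {δ : R} (hδ : ¬ IsSquare (residue R δ)) (h : ¬ IsSquare (-1 : ResidueField R)) :
    ∃ x : R, x ^ 2 = -δ := by
  classical
  have := Fintype.ofFinite (ResidueField R)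
  have hδ0 : residue R δ ≠ 0 := fun h => hδ (h ▸ IsSquare.zero)
  have hc : residue R (-δ) ≠ 0 := by simpa using hδ0
  refine exists_sq_eq_of_isSquare_residue h2 hc ?_
  rw [← quadraticChar_one_iff_isSquare hc, map_neg, ← neg_one_mul, map_mul,
    quadraticChar_neg_one_iff_not_isSquare.2 h, quadraticChar_neg_one_iff_not_isSquare.2 hδ]
  norm_num

theorem exists_sq_add_sq_eq [IsAdicComplete (maximalIdeal R) R] (h2 : IsUnit (2 : R))
    {δ : R} (hδ : residue R δ ≠ 0) : ∃ x y : R, x ^ 2 + y ^ 2 = δ := by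
  have := Fintype.ofFinite (ResidueField R)
  have h2' : ringChar (ResidueField R) ≠ 2 := by
    intro h
    have h0 := ringChar.spec (ResidueField R) 2
    rw [h] at h0
    have h0 := h0.2 dvd_rfl
    exact (h2.map (residue R)).ne_zero (by rw [map_ofNat]; exact_mod_cast h0)
  have hodd := FiniteField.odd_card_of_char_ne_two h2'
  obtain ⟨x, y, hxy⟩ := FiniteField.exists_root_sum_quadratic
    (f := (Polynomial.X ^ 2 : Polynomial (ResidueField R)))
    (g := Polynomial.X ^ 2 - Polynomial.C (residue R δ)) (Polynomial.degree_X_pow 2)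
    (Polynomial.degree_X_pow_sub_C (by decide) _) hodd
  have hxy : x ^ 2 + y ^ 2 = residue R δ := by
    simp at hxy
    linear_combination hxy
  -- Lift `y` arbitrarily and solve for `x` by Hensel, which needs `x ≠ 0`; since `δ` is a unit, one
  -- of the two coordinates qualifies.
  have key : ∀ x y : ResidueField R, x ^ 2 + y ^ 2 = residue R δ → x ≠ 0 →
      ∃ x y : R, x ^ 2 + y ^ 2 = δ := by
    intro x y hxy hx
    obtain ⟨y, rfl⟩ := residue_surjective y
    have e : residue R (δ - y ^ 2) = x ^ 2 := by simp [← hxy]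
    obtain ⟨x, hx⟩ := exists_sq_eq_of_isSquare_residue h2 (c := δ - y ^ 2)
      (by rw [e]; exact pow_ne_zero 2 hx) (by rw [e]; exact IsSquare.sq x)
    exact ⟨x, y, by rw [hx]; ring⟩
  by_cases hx : x = 0
  · refine key y x (by rw [← hxy]; ring) ?_
    rintro rfl
    exact hδ (by rw [← hxy, hx]; simp)
  · exact key x y hxy hx

end SquareRoots

/-! ### Only the pairs in the table occur -/

section TableRows

open IsLocalRing

variable {R : Type*} [CommRing R] [IsLocalRing R]

theorem dvd_and_dvd_of_dvd_sq_sub_mul_sq {π δ : R} (hmax : maximalIdeal R = Ideal.span {π})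
    (hδ : ¬ IsSquare (residue R δ)) (x y : R) (h : π ∣ x ^ 2 - δ * y ^ 2) : π ∣ x ∧ π ∣ y := by
  have hdvd : ∀ x : R, π ∣ x ↔ residue R x = 0 := fun x => by
    rw [residue_eq_zero_iff, hmax, Ideal.mem_span_singleton]
  rw [hdvd] at h
  simp only [map_sub, map_mul, map_pow] at h
  by_cases hy : residue R y = 0
  · rw [hy] at h
    exact ⟨(hdvd x).2 (by simpa using h), (hdvd y).2 hy⟩
  · exact absurd ⟨residue R x / residue R y, by field_simp; linear_combination -h⟩ hδ

theorem SuborderTable.exists_row [IsDomain R] [IsAdicComplete (maximalIdeal R) R]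
    [Finite (ResidueField R)] (h2 : IsUnit (2 : R)) {π δ : R} (hπ : Prime π) (hmax : maximalIdeal R = Ideal.span {π})
    (hδ : ¬ IsSquare (residue R δ)) {a b a' b' : R} (hf : IsBassForm π δ a b)
    (hg : IsBassForm π δ a' b') (C : SuborderCoords π a b a' b') {M : Type*} [AddCommGroup M]
    [Module R M] (e₁ e₂ e₃ : M) :
    ∃ d₁ d₂ d₃ : M, SuborderTable π δ e₁ e₂ e₃ a b a' b' d₁ d₂ d₃ := by
  have hdvd : ∀ x : R, π ∣ x ↔ residue R x = 0 := fun x => by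
    rw [residue_eq_zero_iff, hmax, Ideal.mem_span_singleton]
  have hδ0 : residue R δ ≠ 0 := fun h => hδ (h ▸ IsSquare.zero)
  have hδ' : ¬ π ∣ δ := by rwa [hdvd]
  have h1' : ¬ π ∣ 1 := hπ.not_dvd_one
  have hδsq := dvd_and_dvd_of_dvd_sq_sub_mul_sq hmax hδ
  have hε : ∀ ε, ε = 1 ∨ ε = δ → ¬ π ∣ ε := by rintro ε (rfl | rfl) <;> assumption
  have hsq : ∀ c : R, ¬ π ∣ c → ¬ π ^ 2 ∣ c * π := by
    rintro c hc ⟨k, hk⟩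
    exact hc ⟨k, mul_right_cancel₀ hπ.ne_zero (by rw [hk]; ring)⟩
  -- up to squares, the residue classes of `1` and `δ` are distinct
  have hclass : ∀ m : R, ¬ π ∣ 1 - δ * m ^ 2 := fun m h => h1' (hδsq 1 m (by simpa using h)).1
  have hclass' : ∀ m : R, ¬ π ∣ δ - 1 * m ^ 2 := fun m h =>
    h1' (hδsq m 1 (by rw [← dvd_neg]; convert h using 1; ring)).2
  obtain ⟨β₀, β₁, hβ⟩ := exists_sq_add_sq_eq h2 hδ0
  -- `((1 + π)/2)² - ((1 - π)/2)² = π`.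
  have hα : ∃ α₀ α₁ : R, α₀ ^ 2 - α₁ ^ 2 = π := by
    obtain ⟨t, ht⟩ := h2.exists_right_inv
    exact ⟨t * (1 + π), t * (1 - π), by linear_combination π * (2 * t + 1) * ht⟩
  obtain ⟨α₀, α₁, hα⟩ := hα
  have hne : (1 : R) ≠ δ := fun h => hδ (h ▸ by simp)
  -- From class A to class A: the discriminant gives `t = s + 1` or `t = s + 2`, and for `s ≠ 0` the
  -- norm equation preserves the square class.
  have hAA : ∀ (η : R) (s : ℕ) (η' : R) (t : ℕ), (η = 1 ∨ η = δ) → (η' = 1 ∨ η' = δ) →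
      (η = δ → s ≠ 0) → SuborderCoords π (-η) (π ^ s) (-η') (π ^ t) →
      (η = 1 ∧ η' = 1 ∧ t = s + 1) ∨ (η' = δ ∧ t = s + 2 ∧ (η = δ ∨ s = 0)) := by
    intro η s η' t hη hη' hs C
    have hnorm : s ≠ 0 → π ∣ η' - η * C.x ^ 2 := by
      intro hs
      obtain ⟨n, rfl⟩ : ∃ n, s = n + 1 := ⟨s - 1, by omega⟩
      refine ⟨-π ^ n * C.y ^ 2 + η * π ^ n * C.z ^ 2, ?_⟩
      linear_combination C.norm₁
    have hnη : ¬ π ∣ -η := by rw [dvd_neg]; exact hε η hη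
    have hnη' : ¬ π ∣ -η' := by rw [dvd_neg]; exact hε η' hη'
    rcases C.index with hD | ⟨hD, hE⟩
    · obtain rfl : t = s + 1 := eq_add_of_associated_pow hπ hnη hnη' C.disc
        (d := 1) (by simpa using hD)
      rcases hη' with rfl | rfl
      · rcases hη with rfl | rfl
        · exact Or.inl ⟨rfl, rfl, rfl⟩
        · exact absurd (hnorm (hs rfl)) (hclass _)
      · exfalso
        rcases s with _ | n
        · obtain rfl : η = 1 := hη.resolve_right fun h => hs h rfl
          rw [zero_add, pow_one, pow_zero] at C
          exact C.false_of_split hπ hδsq hδ'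
        · rcases hη with rfl | rfl
          · exact hclass' _ (hnorm (Nat.succ_ne_zero n))
          · exact SuborderCoords.false_of_unramified hπ hδsq hδ' n C
    · obtain rfl : t = s + 2 := eq_add_of_associated_pow hπ hnη hnη' C.disc hD
      rcases hη' with rfl | rfl
      · exfalso
        -- `c = 1` is admissible for `a' = -1`; as `a` is a unit, `π ∣ b`, and the congruences give
        -- the absurd `π ∣ c`.
        obtain ⟨h1, h2, -, -⟩ := hE 1 (by simp)
        exact h1' (h2 ((hπ.dvd_or_dvd h1).resolve_left hnη)).1
      · refine Or.inr ⟨rfl, rfl, ?_⟩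
        by_contra! hcon
        obtain rfl : η = 1 := hη.resolve_right hcon.1
        exact hclass' _ (hnorm hcon.2)
  -- From class A to B or C: only index `π` with `s = t = 1` survives.
  have hABC : ∀ (η : R) (s : ℕ) (ε₁ ε₂ : R) (t : ℕ), (η = 1 ∨ η = δ) → (ε₁ = 1 ∨ ε₁ = δ) →
      (ε₂ = 1 ∨ ε₂ = δ) → t ≠ 0 → (t = 1 → ε₁ = 1) →
      SuborderCoords π (-η) (π ^ s) (ε₁ * π) (ε₂ * π ^ t) →
      s = 1 ∧ t = 1 ∧ ∃ m, π ∣ ε₂ + η * m ^ 2 := by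
    intro η s ε₁ ε₂ t hη hε₁ hε₂ ht ht1 C
    have hnη : ¬ π ∣ -η := by rw [dvd_neg]; exact hε η hη
    have hεε : ¬ π ∣ ε₁ * ε₂ := hπ.not_dvd_mul (hε _ hε₁) (hε _ hε₂)
    have hdisc : -η * π ^ s * C.D = ε₁ * ε₂ * π ^ (t + 1) := by rw [C.disc]; ring
    rcases C.index with hD | ⟨hD, hE⟩
    · obtain rfl : t = s := Nat.succ_injective
        (eq_add_of_associated_pow hπ hnη hεε hdisc (d := 1)
          (by simpa using hD))
      rcases (show t = 1 ∨ 2 ≤ t by omega) with rfl | h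
      · obtain rfl := ht1 rfl
        rw [pow_one, one_mul] at C
        exact ⟨rfl, rfl, C.exists_dvd_add_of_ramified hπ (hε η hη)⟩
      · exact (C.false_of_unit_ramified hπ ht (hε η hη) (dvd_mul_left _ _) (hsq _ (hε _ hε₁))
          (Or.inl h)).elim
    · obtain ⟨h1, -, -, h4⟩ := hE 0 ⟨ε₁, by ring⟩
      rcases Nat.eq_zero_or_pos s with rfl | hs
      · exact absurd (by simpa using h1) (hε η hη)
      · exact (C.false_of_unit_ramified hπ hs.ne' (hε η hη) (dvd_mul_left _ _) (hsq _ (hε _ hε₁))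
          (Or.inr (h4 rfl))).elim
  -- From B or C to A: every coefficient of the norm form is divisible by `π`, so it does not
  -- represent the unit `-η'`.
  have hBCA : ∀ (ε₁ ε₂ : R) (s : ℕ) (η' b' : R), s ≠ 0 → (η' = 1 ∨ η' = δ) →
      SuborderCoords π (ε₁ * π) (ε₂ * π ^ s) (-η') b' → False := by
    intro ε₁ ε₂ s η' b' hs hη' C
    obtain ⟨n, rfl⟩ : ∃ n, s = n + 1 := ⟨s - 1, by omega⟩
    refine hε η' hη' ⟨-(ε₁ * C.x ^ 2 + ε₂ * π ^ n * C.y ^ 2 + ε₁ * ε₂ * π ^ (n + 1) * C.z ^ 2), ?_⟩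
    linear_combination C.norm₁
  -- Within B and C, with B read as `s = 1`, `ε₁ = 1`: index `π²` is impossible and the square
  -- classes multiply.
  have hBCBC : ∀ (ε₁ ε₂ : R) (s : ℕ) (ε₁' ε₂' : R) (t : ℕ), (ε₁ = 1 ∨ ε₁ = δ) →
      (ε₂ = 1 ∨ ε₂ = δ) → (ε₁' = 1 ∨ ε₁' = δ) → (ε₂' = 1 ∨ ε₂' = δ) → s ≠ 0 →
      (s = 1 → ε₁ = 1) → SuborderCoords π (ε₁ * π) (ε₂ * π ^ s) (ε₁' * π) (ε₂' * π ^ t) →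
      t = s + 1 ∧ (2 ≤ s → ε₁ = ε₁') ∧ ((ε₁ = 1 ∧ ε₂ = ε₂') ∨ (ε₁ = δ ∧ ε₂ = 1 ∧ ε₂' = δ) ∨
        (ε₁ = δ ∧ ε₂ = δ ∧ ε₂' = 1)) := by
    intro ε₁ ε₂ s ε₁' ε₂' t hε₁ hε₂ hε₁' hε₂' hs hs1 C
    have hdisc : ε₁ * ε₂ * π ^ (s + 1) * C.D = ε₁' * ε₂' * π ^ (t + 1) := by
      linear_combination C.disc
    rcases C.index with hD | ⟨hD, hE⟩
    · obtain rfl : t = s + 1 := Nat.succ_injective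
        (eq_add_of_associated_pow hπ (hπ.not_dvd_mul (hε _ hε₁) (hε _ hε₂))
          (hπ.not_dvd_mul (hε _ hε₁') (hε _ hε₂')) hdisc (d := 1)
          (by simpa using hD))
      obtain ⟨h1, m, hm⟩ := C.exists_dvd_sub hπ hs hs1 (hε _ hε₁) (hε _ hε₂) (hε _ hε₁')
      refine ⟨rfl, fun h => ?_, ?_⟩
      · obtain ⟨m, hm⟩ := h1 h
        rcases hε₁ with rfl | rfl <;> rcases hε₁' with rfl | rfl
        · rfl
        · exact absurd hm (hclass' m)
        · exact absurd hm (hclass m)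
        · rfl
      · rcases hε₁ with rfl | rfl
        · refine Or.inl ⟨rfl, ?_⟩
          rw [one_mul] at hm
          rcases hε₂ with rfl | rfl <;> rcases hε₂' with rfl | rfl
          · rfl
          · exact absurd hm (hclass' m)
          · exact absurd hm (hclass m)
          · rfl
        · rcases hε₂ with rfl | rfl <;> rcases hε₂' with rfl | rfl
          · exact absurd (by simpa using hm) (hclass m)
          · exact Or.inr (Or.inl ⟨rfl, rfl, rfl⟩)
          · exact Or.inr (Or.inr ⟨rfl, rfl, rfl⟩)
          · rename_i ε
            refine absurd ((hπ.dvd_or_dvd (?_ : π ∣ _ * _)).resolve_left hδ') (hclass m)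
            convert hm using 1
            ring
    · exact (C.false_of_nilpotent hs (dvd_mul_left _ _) (hsq _ (hε _ hε₁')) hE).elim
  -- These three translate the square condition from `hABC` into the quadratic character of `-1`.
  have hsq1 : ∀ m : R, π ∣ 1 + m ^ 2 → IsSquare (-1 : ResidueField R) := by
    intro m hm
    rw [hdvd] at hm
    simp only [map_add, map_pow, map_one] at hm
    exact ⟨residue R m, by linear_combination -hm⟩
  have hsq2 : ∀ m : R, π ∣ δ + m ^ 2 → ¬ IsSquare (-1 : ResidueField R) := by
    rintro m hm ⟨n, hn⟩
    rw [hdvd] at hm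
    simp only [map_add, map_pow] at hm
    exact hδ ⟨n * residue R m, by linear_combination hm + (residue R m) ^ 2 * hn⟩
  have hsq3 : ∀ m : R, π ∣ 1 + δ * m ^ 2 → ¬ IsSquare (-1 : ResidueField R) := by
    rintro m hm ⟨n, hn⟩
    rw [hdvd] at hm
    simp only [map_add, map_mul, map_pow, map_one] at hm
    obtain ⟨n, rfl⟩ := residue_surjective n
    refine hclass (m * n) ((hdvd _).2 ?_)
    simp only [map_sub, map_mul, map_pow, map_one]
    linear_combination hm + residue R δ * residue R m ^ 2 * hn
  have hμ : IsSquare (-1 : ResidueField R) → ∃ μ : R, μ ^ 2 = -1 := fun h =>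
    exists_sq_eq_of_isSquare_residue h2 (by simp) (by simpa using h)
  have hν := exists_sq_eq_neg_of_not_isSquare h2 hδ
  rcases hf with s | ⟨s, hs⟩ | ⟨ε, hε1⟩ | ⟨ε₁, ε₂, hε1, hε2, s, hs⟩
  · rcases hg with t | ⟨t, ht⟩ | ⟨ε', hε1'⟩ | ⟨ε₁', ε₂', hε1', hε2', t, ht⟩
    · obtain ⟨-, -, rfl⟩ | ⟨h, -, -⟩ := hAA 1 s 1 t (.inl rfl) (.inl rfl) (absurd · hne) C
      · exact ⟨_, _, _, .A1_A1 s α₀ α₁ hα⟩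
      · exact absurd h hne
    · obtain ⟨-, h, -⟩ | ⟨-, rfl, h⟩ := hAA 1 s δ t (.inl rfl) (.inr rfl) (absurd · hne) C
      · exact absurd h.symm hne
      · obtain rfl := h.resolve_left hne
        rw [pow_zero, zero_add]
        exact ⟨_, _, _, .A1_A2 β₀ β₁ hβ⟩
    · obtain ⟨rfl, -, m, hm⟩ := hABC 1 s 1 ε' 1 (.inl rfl) (.inl rfl) hε1' one_ne_zero
        (fun _ => rfl) (by rwa [one_mul, pow_one])
      rw [one_mul] at hm
      rw [pow_one]
      rcases hε1' with rfl | rfl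
      · obtain ⟨μ, hμ⟩ := hμ (hsq1 m hm)
        rw [one_mul]
        exact ⟨_, _, _, .A1_B_one (hsq1 m hm) μ hμ⟩
      · obtain ⟨ν, hν⟩ := hν (hsq2 m hm)
        exact ⟨_, _, _, .A1_B_delta (hsq2 m hm) ν hν⟩
    · obtain ⟨-, rfl, -⟩ := hABC 1 s ε₁' ε₂' t (.inl rfl) hε1' hε2' (by omega)
        (fun h => by omega) C
      omega
  · rcases hg with t | ⟨t, ht⟩ | ⟨ε', hε1'⟩ | ⟨ε₁', ε₂', hε1', hε2', t, ht⟩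
    · obtain ⟨h, -, -⟩ | ⟨h, -, -⟩ := hAA δ s 1 t (.inr rfl) (.inl rfl) (fun _ => by omega) C
      · exact absurd h.symm hne
      · exact absurd h hne
    · obtain ⟨h, -, -⟩ | ⟨-, rfl, -⟩ := hAA δ s δ t (.inr rfl) (.inr rfl) (fun _ => by omega) C
      · exact absurd h.symm hne
      · exact ⟨_, _, _, .A2_A2 s hs⟩
    · obtain ⟨rfl, -, m, hm⟩ := hABC δ s 1 ε' 1 (.inr rfl) (.inl rfl) hε1' one_ne_zero
        (fun _ => rfl) (by rwa [one_mul, pow_one])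
      rw [pow_one]
      rcases hε1' with rfl | rfl
      · obtain ⟨ν, hν⟩ := hν (hsq3 m hm)
        rw [one_mul]
        exact ⟨_, _, _, .A2_B_one (hsq3 m hm) ν hν⟩
      · have h := hsq1 m ((hπ.dvd_or_dvd (by convert hm using 1; ring)).resolve_left hδ')
        obtain ⟨μ, hμ⟩ := hμ h
        exact ⟨_, _, _, .A2_B_delta h μ hμ⟩
    · obtain ⟨-, rfl, -⟩ := hABC δ s ε₁' ε₂' t (.inr rfl) hε1' hε2' (by omega)
        (fun h => by omega) C
      omega
  · rcases hg with t | ⟨t, ht⟩ | ⟨ε', hε1'⟩ | ⟨ε₁', ε₂', hε1', hε2', t, ht⟩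
    · exact (hBCA 1 ε 1 1 _ one_ne_zero (.inl rfl) (by rwa [one_mul, pow_one])).elim
    · exact (hBCA 1 ε 1 δ _ one_ne_zero (.inr rfl) (by rwa [one_mul, pow_one])).elim
    · have := hBCBC 1 ε 1 1 ε' 1 (.inl rfl) hε1 (.inl rfl) hε1' one_ne_zero (fun _ => rfl)
        (by rwa [one_mul, pow_one])
      omega
    · obtain ⟨rfl, -, h⟩ := hBCBC 1 ε 1 ε₁' ε₂' t (.inl rfl) hε1 hε1' hε2' one_ne_zero
        (fun _ => rfl) (by rwa [one_mul, pow_one])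
      obtain ⟨-, rfl⟩ | ⟨h, -⟩ | ⟨h, -⟩ := h
      · rcases hε1 with rfl | rfl <;> rcases hε1' with rfl | rfl <;> try simp only [one_mul]
        · exact ⟨_, _, _, .B_one_C_one⟩
        · exact ⟨_, _, _, .B_one_C_delta β₀ β₁ hβ⟩
        · exact ⟨_, _, _, .B_delta_C_one⟩
        · exact ⟨_, _, _, .B_delta_C_delta⟩
      · exact absurd h hne
      · exact absurd h hne
  · rcases hg with t | ⟨t, ht⟩ | ⟨ε', hε1'⟩ | ⟨ε₁', ε₂', hε1', hε2', t, ht⟩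
    · exact (hBCA ε₁ ε₂ s 1 _ (by omega) (.inl rfl) C).elim
    · exact (hBCA ε₁ ε₂ s δ _ (by omega) (.inr rfl) C).elim
    · have := hBCBC ε₁ ε₂ s 1 ε' 1 hε1 hε2 (.inl rfl) hε1' (by omega) (fun _ => by omega)
        (by rwa [one_mul, pow_one])
      omega
    · obtain ⟨rfl, h1, h⟩ := hBCBC ε₁ ε₂ s ε₁' ε₂' t hε1 hε2 hε1' hε2' (by omega)
        (fun _ => by omega) C
      obtain rfl := h1 hs
      obtain ⟨rfl, rfl⟩ | ⟨rfl, rfl, rfl⟩ | ⟨rfl, rfl, rfl⟩ := h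
      · rcases hε2 with rfl | rfl <;> try simp only [one_mul]
        · exact ⟨_, _, _, .C_one_one s hs⟩
        · exact ⟨_, _, _, .C_one_delta s hs⟩
      · simp only [one_mul]
        exact ⟨_, _, _, .C_delta_one s hs⟩
      · simp only [one_mul]
        exact ⟨_, _, _, .C_delta_delta s hs⟩

end TableRows

/-! ### Transport of maximal suborders along isomorphisms -/

section Orders

variable {R : Type v} {F : Type u} {B : Type w} [CommRing R] [Field F]
  [Algebra R F] [Ring B] [Algebra F B] [Algebra R B] [IsScalarTower R F B]

theorem IsOrder.of_le_of_le [IsNoetherianRing R] {O₁ O₂ O₃ : Subalgebra R B} (h₁ : IsOrder F O₁)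
    (h₃ : IsOrder F O₃)
    (h₁₂ : O₁ ≤ O₂) (h₂₃ : O₂ ≤ O₃) : IsOrder F O₂ := by
  have := isNoetherian_of_fg_of_noetherian _ h₃.fg
  refine ⟨isNoetherian_submodule.1 this _ h₂₃, top_le_iff.1 ?_⟩
  rw [← h₁.span_eq_top]
  exact Submodule.span_mono h₁₂

/-- A maximal suborder becomes a maximal subalgebra under an isomorphism of the larger order. -/
theorem IsMaximalSuborder.isCoatom_comap [IsNoetherianRing R] {O O' : Subalgebra R B}
    (hO : IsOrder F O)
    (h : IsMaximalSuborder F O' O) {A : Type*} [Ring A] [Algebra R A] (f : A ≃ₐ[R] O) :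
    IsCoatom (O'.comap (O.val.comp f.toAlgHom)) := by
  obtain ⟨hO', hlt, hmax⟩ := h
  set φ := O.val.comp f.toAlgHom with hφ
  have hrange : ∀ x ∈ O, ∃ t, φ t = x := fun x hx => ⟨f.symm ⟨x, hx⟩, by simp [hφ]⟩
  have hmem : ∀ t, φ t ∈ O := fun t => (f t).2
  have hinj : Function.Injective φ := Subtype.val_injective.comp f.injective
  constructor
  · intro htop
    refine hlt.not_ge fun x hx => ?_
    obtain ⟨t, rfl⟩ := hrange x hx
    exact (htop ▸ Algebra.mem_top : t ∈ O'.comap φ)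
  · intro T hT
    have h1 : O' ≤ T.map φ := by
      intro x hx
      obtain ⟨t, rfl⟩ := hrange x (hlt.le hx)
      exact ⟨t, hT.le hx, rfl⟩
    have h2 : T.map φ ≤ O := by
      rintro _ ⟨t, -, rfl⟩
      exact hmem t
    have h3 : O' < T.map φ := by
      refine lt_of_le_of_ne h1 fun h => hT.not_ge fun t ht => ?_
      change φ t ∈ O'
      rw [h]
      exact ⟨t, ht, rfl⟩
    have h4 := hmax _ (hO'.of_le_of_le hO h1 h2) h3 h2
    refine top_le_iff.1 fun t _ => ?_
    obtain ⟨t', ht', h⟩ := (h4 ▸ hmem t : φ t ∈ T.map φ)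
    exact hinj h ▸ ht'

/-- The preimage of `O' ≤ O` under an isomorphism onto `O` is isomorphic to `O'`. -/
theorem Subalgebra.nonempty_comap_equiv {O O' : Subalgebra R B} (h : O' ≤ O) {A : Type*} [Ring A]
    [Algebra R A] (f : A ≃ₐ[R] O) : Nonempty (O' ≃ₐ[R] O'.comap (O.val.comp f.toAlgHom)) := by
  set φ := O.val.comp f.toAlgHom with hφ
  have hinj : Function.Injective φ := Subtype.val_injective.comp f.injective
  have e : (O'.comap φ).map φ = O' := by
    ext x
    constructor
    · rintro ⟨t, ht, rfl⟩
      exact ht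
    · intro hx
      have hx' : φ (f.symm ⟨x, h hx⟩) = x := by simp [hφ]
      exact ⟨f.symm ⟨x, h hx⟩, by
        change φ _ ∈ O'
        rwa [hx'], hx'⟩
  exact ⟨((Subalgebra.equivMapOfInjective _ φ hinj).trans (Subalgebra.equivOfEq _ _ e)).symm⟩

end Orders

/-! ### From forms beneath to coordinates -/

section Beneath

variable {R : Type v} [CommRing R] [IsDomain R] [IsDiscreteValuationRing R] {F : Type u} [Field F]
  [Algebra R F]

theorem IsBassForm.ne_zero {π δ : R} (hπ : Prime π) (hδ : ¬ π ∣ δ) {a b : R}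
    (h : IsBassForm π δ a b) : a ≠ 0 ∧ b ≠ 0 ∧ ¬ π ^ 2 ∣ a := by
  have hε : ∀ ε, ε = 1 ∨ ε = δ → ¬ π ∣ ε := by
    rintro ε (rfl | rfl)
    exacts [hπ.not_dvd_one, hδ]
  have h0 : ∀ ε, ¬ π ∣ ε → ε ≠ 0 := fun ε h h' => h (h' ▸ dvd_zero π)
  have hu : ∀ ε, ¬ π ∣ ε → ¬ π ^ 2 ∣ ε := fun ε h h' => h ((dvd_pow_self π two_ne_zero).trans h')
  have hsq : ∀ c : R, ¬ π ∣ c → ¬ π ^ 2 ∣ c * π := by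
    rintro c hc ⟨k, hk⟩
    exact hc ⟨k, mul_right_cancel₀ hπ.ne_zero (by rw [hk]; ring)⟩
  have hπ0 := hπ.ne_zero
  rcases h with s | ⟨s, hs⟩ | ⟨ε, h1⟩ | ⟨ε₁, ε₂, h1, h2, s, hs⟩
  · exact ⟨by simp, pow_ne_zero _ hπ0, hu _ (by simpa using hπ.not_dvd_one)⟩
  · exact ⟨by simpa using h0 _ hδ, pow_ne_zero _ hπ0, hu _ (by simpa using hδ)⟩
  · exact ⟨hπ0, mul_ne_zero (h0 _ (hε _ h1)) hπ0, by simpa using hsq 1 hπ.not_dvd_one⟩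
  · exact ⟨mul_ne_zero (h0 _ (hε _ h1)) hπ0, mul_ne_zero (h0 _ (hε _ h2)) (pow_ne_zero _ hπ0),
      hsq _ (hε _ h1)⟩

theorem IsBeneath.nonempty_suborderCoords (h2 : IsUnit (2 : R)) {π δ : R} (hπ : Irreducible π)
    (hδ : ¬ π ∣ δ) {a b a' b' : R} (h : IsBeneath F π δ a b a' b') :
    Nonempty (SuborderCoords π a b a' b') := by
  obtain ⟨-, hg, B, _, _, _, _, -, O, O', hO, ⟨f⟩, hmax, ⟨g⟩⟩ := h
  obtain ⟨ha', hb', ha'2⟩ := hg.ne_zero hπ.prime hδ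
  have f' := (f.trans (evenTernaryFormEquiv a b)).symm
  obtain ⟨k⟩ := Subalgebra.nonempty_comap_equiv hmax.2.1.le f'
  exact SuborderCoords.nonempty hπ.prime
    ((IsDiscreteValuationRing.irreducible_iff_uniformizer π).1 hπ)
    (fun h => hπ.not_isUnit (isUnit_of_dvd_unit h h2)) ha' hb' ha'2
    (hmax.isCoatom_comap hO f') ((g.trans (evenTernaryFormEquiv a' b')).symm.trans k)

end Beneath

/-! ### Faithfulness of quaternion multiplication tables -/

section QuaternionLift

variable {R : Type*} [CommRing R] [IsDomain R] {A : Type*} [Ring A] [Algebra R A]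

/-- The kernel is a two-sided ideal: `aX - iXi` isolates `2a(re + imI i)` and the same device with
`j` isolates the real part, which vanishes by torsion-freeness. Applied to `Xi`, `Xj`, `Xk` this
kills the other coordinates. -/
theorem QuaternionAlgebra.Basis.liftHom_injective [Nontrivial A] [Module.IsTorsionFree R A]
    (h2 : (2 : R) ≠ 0) {a b : R} (ha : a ≠ 0) (hb : b ≠ 0)
    (q : QuaternionAlgebra.Basis A (-a) 0 (-b)) : Function.Injective q.liftHom := by
  have hre : ∀ X, q.liftHom X = 0 → X.re = 0 := by
    intro X hX
    have h1 : q.liftHom ((2 * a) • ⟨X.re, X.imI, 0, 0⟩) = 0 := by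
      have e : ((2 * a) • ⟨X.re, X.imI, 0, 0⟩ : ℍ[R,-a,-b]) =
          a • X - (⟨0, 1, 0, 0⟩ : ℍ[R,-a,-b]) * X * ⟨0, 1, 0, 0⟩ := by
        ext <;> simp <;> ring
      rw [e, map_sub, map_mul, map_mul, map_smul, hX, smul_zero, mul_zero, zero_mul, sub_zero]
    rw [map_smul, smul_eq_zero_iff_right (mul_ne_zero h2 ha)] at h1
    have h3 : q.liftHom ((2 * b * X.re) • 1) = 0 := by
      have e : ((2 * b * X.re) • 1 : ℍ[R,-a,-b]) = b • ⟨X.re, X.imI, 0, 0⟩ -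
          (⟨0, 0, 1, 0⟩ : ℍ[R,-a,-b]) * ⟨X.re, X.imI, 0, 0⟩ * ⟨0, 0, 1, 0⟩ := by
        ext <;> simp
        ring
      rw [e]
      simp only [map_sub, map_mul, map_smul, h1]
      simp
    rw [map_smul, map_one, smul_eq_zero_iff_left one_ne_zero] at h3
    exact (mul_eq_zero.1 h3).resolve_left (mul_ne_zero h2 hb)
  refine (injective_iff_map_eq_zero _).2 fun X hX => ?_
  have hI := hre (X * ⟨0, 1, 0, 0⟩) (by rw [map_mul, hX, zero_mul])
  have hJ := hre (X * ⟨0, 0, 1, 0⟩) (by rw [map_mul, hX, zero_mul])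
  have hK := hre (X * ⟨0, 0, 0, 1⟩) (by rw [map_mul, hX, zero_mul])
  simp [ha, hb] at hI hJ hK
  ext
  exacts [hre X hX, hI, hJ, hK]

end QuaternionLift

/-! ### A criterion for maximal suborders -/

section Rows

variable {R : Type v} [CommRing R]

theorem mem_span_quadruple {M : Type*} [AddCommGroup M] [Module R M] {x d₀ d₁ d₂ d₃ : M} :
    x ∈ Submodule.span R {d₀, d₁, d₂, d₃} ↔
      ∃ p q r s : R, x = p • d₀ + q • d₁ + r • d₂ + s • d₃ := by
  simp only [Submodule.mem_span_insert, Submodule.mem_span_singleton]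
  constructor
  · rintro ⟨p, _, ⟨q, _, ⟨r, _, ⟨s, rfl⟩, rfl⟩, rfl⟩, rfl⟩
    exact ⟨p, q, r, s, by abel⟩
  · rintro ⟨p, q, r, s, rfl⟩
    exact ⟨p, _, ⟨q, _, ⟨r, _, ⟨s, rfl⟩, rfl⟩, rfl⟩, by abel⟩

theorem Module.Basis.exists_eq_quadruple {M : Type*} [AddCommGroup M] [Module R M]
    (e : Module.Basis (Fin 4) R M) (x : M) :
    ∃ p q r s : R, x = p • e 0 + q • e 1 + r • e 2 + s • e 3 :=
  ⟨_, _, _, _, by rw [← Fin.sum_univ_four (fun i => e.repr x i • e i), e.sum_repr]⟩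

variable {F : Type u} {B : Type w} [IsDomain R] [IsNoetherianRing R] [Field F]
  [Algebra R F] [IsFractionRing R F] [Ring B] [Algebra F B] [Algebra R B] [IsScalarTower R F B]

/-- Criterion for `⟨1, d₁, d₂, d₃⟩` to be a maximal suborder corresponding to `⟨1, a', b'⟩`:
modulo `π` the elements `dᵢ` agree with elements `tᵢ` satisfying the right multiplication table. -/
theorem exists_isMaximalSuborder {π : R} (hπ0 : π ≠ 0)
    (h2 : (2 : R) ≠ 0) {O : Subalgebra R B} (hO : IsOrder F O) (e e' : Module.Basis (Fin 4) R O)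
    (he : e 0 = 1) (he' : e' 0 = 1) {a' b' c : R} (ha' : a' ≠ 0) (hb' : b' ≠ 0) (hc : IsUnit c)
    {d₁ d₂ d₃ t₁ t₂ t₃ : O}
    (hd : ∀ i : Fin 4, i ≠ 0 → π • e i ∈ Submodule.span R {1, d₁, d₂, d₃})
    (ht : ∀ i : Fin 4, i ≠ 0 → π • e' i ∈ Submodule.span R {1, t₁, t₂, t₃})
    (h₁ : ∃ x, t₁ - d₁ = π • x) (h₂ : ∃ x, t₂ - d₂ = π • x) (h₃ : ∃ x, t₃ - d₃ = π • x)
    (h33 : t₃ * t₃ = (-a') • 1) (h22 : t₂ * t₂ = (-b') • 1) (h32 : t₃ * t₂ = c • t₁)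
    (h23 : t₂ * t₃ = -(c • t₁)) (l : O →ₗ[R] R) (hl0 : π ∣ l 1) (hl1 : π ∣ l t₁) (hl2 : π ∣ l t₂)
    (hl3 : π ∣ l t₃) (v : O) (hlv : ¬ π ∣ l v)
    (hv : ∀ x, ∃ r s : R, x - (r • v + s • (t₃ * v)) ∈ Submodule.span R {1, t₁, t₂, t₃} ∧
      (¬ (π ∣ r ∧ π ∣ s) → IsUnit (r ^ 2 + a' * s ^ 2))) :
    ∃ O' : Subalgebra R B,
      Subalgebra.toSubmodule O' = Submodule.span R {1, (d₁ : B), (d₂ : B), (d₃ : B)} ∧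
      IsMaximalSuborder F O' O ∧ Corresponds O' a' b' := by
  have hle : ∀ (f : Module.Basis (Fin 4) R O) (N : Submodule R O), f 0 = 1 → 1 ∈ N →
      (∀ i : Fin 4, i ≠ 0 → π • f i ∈ N) → ∀ x, π • x ∈ N := by
    intro f N hf h1 hN x
    obtain ⟨p, q, r, s, rfl⟩ := f.exists_eq_quadruple x
    rw [hf]
    simp only [smul_add, smul_comm π _ (f _), smul_comm π _ (1 : O)]
    exact add_mem (add_mem (add_mem (N.smul_mem _ (N.smul_mem _ h1))
      (N.smul_mem _ (hN 1 (by decide)))) (N.smul_mem _ (hN 2 (by decide))))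
      (N.smul_mem _ (hN 3 (by decide)))
  have hd := hle e _ he (Submodule.subset_span (by simp)) hd
  have ht := hle e' _ he' (Submodule.subset_span (by simp)) ht
  -- Both spans contain `πO`, and their generators agree modulo `πO`.
  have hspan : Submodule.span R {1, d₁, d₂, d₃} = Submodule.span R {1, t₁, t₂, t₃} := by
    obtain ⟨x₁, h₁⟩ := h₁
    obtain ⟨x₂, h₂⟩ := h₂
    obtain ⟨x₃, h₃⟩ := h₃
    apply le_antisymm <;> rw [Submodule.span_le] <;>
      simp only [Set.insert_subset_iff, Set.singleton_subset_iff] <;> refine ⟨?_, ?_, ?_, ?_⟩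
    · exact Submodule.subset_span (by simp)
    · rw [SetLike.mem_coe, show d₁ = t₁ - π • x₁ by rw [← h₁]; abel]
      exact sub_mem (Submodule.subset_span (by simp)) (ht _)
    · rw [SetLike.mem_coe, show d₂ = t₂ - π • x₂ by rw [← h₂]; abel]
      exact sub_mem (Submodule.subset_span (by simp)) (ht _)
    · rw [SetLike.mem_coe, show d₃ = t₃ - π • x₃ by rw [← h₃]; abel]
      exact sub_mem (Submodule.subset_span (by simp)) (ht _)
    · exact Submodule.subset_span (by simp)
    · rw [SetLike.mem_coe, show t₁ = d₁ + π • x₁ by rw [← h₁]; abel]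
      exact add_mem (Submodule.subset_span (by simp)) (hd _)
    · rw [SetLike.mem_coe, show t₂ = d₂ + π • x₂ by rw [← h₂]; abel]
      exact add_mem (Submodule.subset_span (by simp)) (hd _)
    · rw [SetLike.mem_coe, show t₃ = d₃ + π • x₃ by rw [← h₃]; abel]
      exact add_mem (Submodule.subset_span (by simp)) (hd _)
  have hfree : Module.Free R O := Module.Free.of_basis e
  have hnt : Nontrivial O := ⟨e 0, e 1, fun h => by simpa using e.injective h⟩
  let q : QuaternionAlgebra.Basis O (-a') 0 (-b') :=
    { i := t₃, j := t₂, k := c • t₁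
      i_mul_i := by rw [h33, zero_smul, add_zero]
      j_mul_j := h22
      i_mul_j := h32
      j_mul_i := by rw [h23, zero_smul, zero_sub] }
  have hqinj := q.liftHom_injective h2 ha' hb'
  have hN : ∀ x, x ∈ q.liftHom.range ↔ x ∈ Submodule.span R {1, t₁, t₂, t₃} := by
    intro x
    rw [mem_span_quadruple]
    constructor
    · rintro ⟨t, rfl⟩
      refine ⟨t.re, t.imK * c, t.imJ, t.imI, ?_⟩
      change algebraMap R O _ + _ + _ + _ = _
      rw [Algebra.algebraMap_eq_smul_one]
      change _ + _ • t₃ + _ • t₂ + _ • c • t₁ = _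
      module
    · rintro ⟨p, q', r, s, rfl⟩
      obtain ⟨c, rfl⟩ := hc
      refine ⟨⟨p, s, r, q' * (↑c⁻¹ : R)⟩, ?_⟩
      change algebraMap R O _ + _ • t₃ + _ • t₂ + _ • (c : R) • t₁ = _
      rw [Algebra.algebraMap_eq_smul_one, smul_smul, mul_assoc, Units.inv_mul, mul_one]
      abel
  refine ⟨q.liftHom.range.map O.val, ?_, ?_, ?_⟩
  · have e1 : Subalgebra.toSubmodule q.liftHom.range = Submodule.span R {1, d₁, d₂, d₃} := by
      rw [hspan]
      ext x
      exact hN x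
    rw [Subalgebra.map_toSubmodule, e1, Submodule.map_span]
    simp [Set.image_insert_eq]
  · have hO'O : q.liftHom.range.map O.val ≤ O := by
      rintro _ ⟨x, -, rfl⟩
      exact x.2
    refine ⟨⟨?_, ?_⟩, lt_of_le_of_ne hO'O ?_, ?_⟩
    · have := isNoetherian_of_fg_of_noetherian _ hO.fg
      exact isNoetherian_submodule.1 this _ hO'O
    · rw [← top_le_iff, ← hO.span_eq_top, Submodule.span_le]
      intro x hx
      have hπF : algebraMap R F π ≠ 0 := by
        rwa [Ne, FaithfulSMul.algebraMap_eq_zero_iff]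
      have hx' : π • x ∈ q.liftHom.range.map O.val :=
        ⟨π • ⟨x, hx⟩, (hN _).2 (ht _), rfl⟩
      have e1 : x = (algebraMap R F π)⁻¹ • π • x := by
        rw [← algebraMap_smul F π x, smul_smul, inv_mul_cancel₀ hπF, one_smul]
      rw [e1]
      exact Submodule.smul_mem _ _ (Submodule.subset_span hx')
    -- Modulo `π` the functional `l` vanishes on the span but not at `v`, so the suborder is proper.
    · intro heq
      obtain ⟨v', hv', h⟩ : (v : B) ∈ q.liftHom.range.map O.val := by
        rw [heq]
        exact v.2
      obtain rfl : v' = v := Subtype.ext h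
      obtain ⟨p, q', r, s, rfl⟩ := mem_span_quadruple.1 ((hN _).1 hv')
      refine hlv ?_
      simp only [map_add, map_smul, smul_eq_mul]
      exact (((hl0.mul_left _).add (hl1.mul_left _)).add (hl2.mul_left _)).add (hl3.mul_left _)
    · intro O₂ hO₂ hlt hle₂
      obtain ⟨y, hy, hy'⟩ := Set.exists_of_ssubset hlt
      have hyO := hle₂ hy
      have hin : ∀ x : O, x ∈ Submodule.span R {1, t₁, t₂, t₃} → (x : B) ∈ O₂ := fun x hx =>
        hlt.le ⟨x, (hN x).2 hx, rfl⟩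
      obtain ⟨r, s, hrs, hunit⟩ := hv ⟨y, hyO⟩
      by_cases hdiv : π ∣ r ∧ π ∣ s
      · obtain ⟨⟨r, rfl⟩, ⟨s, rfl⟩⟩ := hdiv
        refine absurd ⟨⟨y, hyO⟩, (hN _).2 ?_, rfl⟩ hy'
        have e1 := add_mem hrs (ht (r • v + s • (t₃ * v)))
        convert e1 using 1
        module
      · obtain ⟨k, hk⟩ := (hunit hdiv).exists_left_inv
        have ht₃ : (t₃ : B) ∈ O₂ := hin t₃ (Submodule.subset_span (by simp))
        have hw : ((r • v + s • (t₃ * v) : O) : B) ∈ O₂ := by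
          have e1 := sub_mem hy (hin _ hrs)
          convert e1 using 1
          push_cast
          abel
        -- Modulo the suborder the new element is `(r + s t₃)v`; multiplying by the conjugate `r - s
        -- t₃` leaves the unit `r² + a's²` times `v`.
        have hvO₂ : (v : B) ∈ O₂ := by
          have e1 : v = k • ((r • 1 - s • t₃) * (r • v + s • (t₃ * v))) := by
            have e2 : (r • 1 - s • t₃) * (r • v + s • (t₃ * v)) = (r ^ 2 + a' * s ^ 2) • v := by
              simp only [sub_mul, mul_add, smul_mul_assoc, mul_smul_comm, one_mul, ← mul_assoc, h33]
              module
            rw [e2, smul_smul, hk, one_smul]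
          rw [e1]
          exact O₂.smul_mem (mul_mem (sub_mem (O₂.smul_mem (one_mem _) _)
            (O₂.smul_mem ht₃ _)) hw) _
        refine le_antisymm hle₂ fun z hz => ?_
        obtain ⟨r', s', hz', -⟩ := hv ⟨z, hz⟩
        have e1 := add_mem (hin _ hz')
          (add_mem (O₂.smul_mem hvO₂ r') (O₂.smul_mem (mul_mem ht₃ hvO₂) s'))
        convert e1 using 1
        push_cast
        abel
  · exact ⟨(((AlgEquiv.ofInjective _ hqinj).trans
      (Subalgebra.equivMapOfInjective _ O.val Subtype.val_injective)).symm).trans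
      (evenTernaryFormEquiv a' b').symm⟩

end Rows

/-! ### Rows that rescale basis vectors -/

section TableRows

variable {R : Type v} {F : Type u} {B : Type w} [CommRing R] [IsDomain R] [IsNoetherianRing R]
  [Field F] [Algebra R F] [IsFractionRing R F] [Ring B] [Algebra F B] [Algebra R B]
  [IsScalarTower R F B]

/-- Variant of `exists_isMaximalSuborder` for elements which are given by linear expressions
`Dᵢ` in a basis congruent to a good one. -/
theorem exists_isMaximalSuborder_of_linear {π : R} (hπ0 : π ≠ 0) (h2 : (2 : R) ≠ 0)
    {O : Subalgebra R B} (hO : IsOrder F O) {a b : R} {e e' : Module.Basis (Fin 4) R O}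
    (he : e 0 = 1) (he' : IsGoodBasis a b e')
    (hee' : ∀ i : Fin 4, i ≠ 0 → ∃ x, e' i - e i = π • x)
    {a' b' c : R} (ha' : a' ≠ 0) (hb' : b' ≠ 0) (hc : IsUnit c) (D₁ D₂ D₃ : O → O → O → O)
    (hD₁ : ∀ x y z x' y' z', D₁ (x + π • x') (y + π • y') (z + π • z') =
      D₁ x y z + π • D₁ x' y' z')
    (hD₂ : ∀ x y z x' y' z', D₂ (x + π • x') (y + π • y') (z + π • z') =
      D₂ x y z + π • D₂ x' y' z')
    (hD₃ : ∀ x y z x' y' z', D₃ (x + π • x') (y + π • y') (z + π • z') =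
      D₃ x y z + π • D₃ x' y' z')
    (hspan : ∀ x y z : O, π • x ∈ Submodule.span R {1, D₁ x y z, D₂ x y z, D₃ x y z} ∧
      π • y ∈ Submodule.span R {1, D₁ x y z, D₂ x y z, D₃ x y z} ∧
      π • z ∈ Submodule.span R {1, D₁ x y z, D₂ x y z, D₃ x y z})
    {t₁ t₂ t₃ : O} (ht₁ : D₁ (e' 1) (e' 2) (e' 3) = t₁) (ht₂ : D₂ (e' 1) (e' 2) (e' 3) = t₂)
    (ht₃ : D₃ (e' 1) (e' 2) (e' 3) = t₃)
    (h33 : t₃ * t₃ = (-a') • 1) (h22 : t₂ * t₂ = (-b') • 1) (h32 : t₃ * t₂ = c • t₁)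
    (h23 : t₂ * t₃ = -(c • t₁)) (l : Fin 4 → R) (hl0 : l 0 = 0)
    (hl1 : π ∣ e'.constr ℕ l t₁) (hl2 : π ∣ e'.constr ℕ l t₂)
    (hl3 : π ∣ e'.constr ℕ l t₃) (v : O) (hlv : ¬ π ∣ e'.constr ℕ l v)
    (hv : ∀ p q r : R, ∃ r' s' : R,
      (∃ m₀ m₁ m₂ m₃ : R, p • e' 1 + q • e' 2 + r • e' 3 - (r' • v + s' • (t₃ * v)) =
        m₀ • 1 + m₁ • t₁ + m₂ • t₂ + m₃ • t₃) ∧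
      (¬ (π ∣ r' ∧ π ∣ s') → IsUnit (r' ^ 2 + a' * s' ^ 2))) {d₁ d₂ d₃ : B}
    (hd₁ : d₁ = (D₁ (e 1) (e 2) (e 3) : O)) (hd₂ : d₂ = (D₂ (e 1) (e 2) (e 3) : O))
    (hd₃ : d₃ = (D₃ (e 1) (e 2) (e 3) : O)) :
    ∃ O' : Subalgebra R B,
      Subalgebra.toSubmodule O' = Submodule.span R {1, d₁, d₂, d₃} ∧
      IsMaximalSuborder F O' O ∧ Corresponds O' a' b' := by
  have hdiff : ∀ D : O → O → O → O, (∀ x y z x' y' z', D (x + π • x') (y + π • y') (z + π • z') =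
      D x y z + π • D x' y' z') →
      ∃ x, D (e' 1) (e' 2) (e' 3) - D (e 1) (e 2) (e 3) = π • x := by
    intro D hD
    obtain ⟨x, hx⟩ := hee' 1 (by decide)
    obtain ⟨y, hy⟩ := hee' 2 (by decide)
    obtain ⟨z, hz⟩ := hee' 3 (by decide)
    refine ⟨D x y z, ?_⟩
    rw [sub_eq_iff_eq_add'] at hx hy hz
    rw [hx, hy, hz, hD]
    abel
  have hall : ∀ f : Module.Basis (Fin 4) R O, ∀ i : Fin 4, i ≠ 0 → π • f i ∈ Submodule.span R
      {1, D₁ (f 1) (f 2) (f 3), D₂ (f 1) (f 2) (f 3), D₃ (f 1) (f 2) (f 3)} := by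
    intro f i hi
    obtain ⟨h1, h2, h3⟩ := hspan (f 1) (f 2) (f 3)
    fin_cases i
    exacts [absurd rfl hi, h1, h2, h3]
  subst ht₁ ht₂ ht₃ hd₁ hd₂ hd₃
  refine exists_isMaximalSuborder hπ0 h2 hO e e' he he'.e0 ha' hb' hc (hall e) (hall e')
    (hdiff D₁ hD₁) (hdiff D₂ hD₂) (hdiff D₃ hD₃) h33 h22 h32 h23 (e'.constr ℕ l) ?_ hl1 hl2 hl3 v hlv
    fun x => ?_
  · rw [← he'.e0, Module.Basis.constr_basis, hl0]
    exact dvd_zero π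
  · obtain ⟨p₀, p, q, r, rfl⟩ := e'.exists_eq_quadruple x
    obtain ⟨r', s', ⟨m₀, m₁, m₂, m₃, h⟩, hu⟩ := hv p q r
    refine ⟨r', s', mem_span_quadruple.2 ⟨p₀ + m₀, m₁, m₂, m₃, ?_⟩, hu⟩
    rw [he'.e0]
    linear_combination (norm := module) h

/-- The rows of the table with `d = (u π e₃, u' e₁, e₂)`. -/
theorem exists_isMaximalSuborder_of_eq_smul_three {π : R} (hπ : Prime π)
    (hunit : ∀ r : R, ¬ π ∣ r → IsUnit r) (h2 : (2 : R) ≠ 0)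
    {O : Subalgebra R B} (hO : IsOrder F O) {a b : R} {e e' : Module.Basis (Fin 4) R O}
    (he : e 0 = 1) (he' : IsGoodBasis a b e')
    (hee' : ∀ i : Fin 4, i ≠ 0 → ∃ x, e' i - e i = π • x) {b' u u' c : R}
    (hb : b ≠ 0) (hb' : b' ≠ 0) (hu : IsUnit u) (hu' : IsUnit u') (hc : IsUnit c)
    (h22 : u' ^ 2 * (a * b) = b') (h32 : u' * b = c * (u * π)) {d₁ d₂ d₃ : B}
    (hd₁ : d₁ = ((u * π) • e 3 : O)) (hd₂ : d₂ = (u' • e 1 : O)) (hd₃ : d₃ = (e 2 : O)) :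
    ∃ O' : Subalgebra R B,
      Subalgebra.toSubmodule O' = Submodule.span R {1, d₁, d₂, d₃} ∧
      IsMaximalSuborder F O' O ∧ Corresponds O' b b' := by
  obtain ⟨w, hw⟩ := hu.exists_left_inv
  obtain ⟨w', hw'⟩ := hu'.exists_left_inv
  -- The quotient is the residue field, generated by `e₃` and detected by its coordinate. Since `t₃
  -- = e₂` has square `-b`, the first coefficient of the new form is `b`.
  refine exists_isMaximalSuborder_of_linear hπ.ne_zero h2 hO he he' hee' hb hb' hc
    (fun _ _ z => (u * π) • z) (fun x _ _ => u' • x) (fun _ y _ => y)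
    (by intros; module) (by intros; module) (by intros; module) ?_ rfl rfl rfl ?_ ?_ ?_ ?_
    ![0, 0, 0, 1] rfl ?_ ?_ ?_ (e' 3) ?_ ?_ hd₁ hd₂ hd₃
  · refine fun x y z => ⟨mem_span_quadruple.2 ⟨0, 0, π * w', 0, ?_⟩,
      mem_span_quadruple.2 ⟨0, 0, 0, π, ?_⟩, mem_span_quadruple.2 ⟨0, w, 0, 0, ?_⟩⟩
    · linear_combination (norm := module) (-π * hw') • x
    · module
    · linear_combination (norm := module) (-π * hw) • z
  · rw [he'.e22, Algebra.algebraMap_eq_smul_one]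
  · rw [smul_mul_smul_comm, he'.e11, Algebra.algebraMap_eq_smul_one, smul_smul, ← h22]
    congr 1
    ring
  · rw [mul_smul_comm, he'.e21, smul_smul, smul_smul, h32]
  · rw [smul_mul_assoc, he'.e12, smul_neg, smul_smul, smul_smul, h32]
  · simp
  · simp
  · simp
  · simpa using hπ.not_dvd_one
  · refine fun p q r => ⟨r, 0, ⟨0, 0, p * w', q, ?_⟩, fun h => ?_⟩
    · linear_combination (norm := module) (-p * hw') • e' 1
    · simp only [dvd_zero, and_true] at h
      simpa using hunit r h

/-- The rows of the table with `d = (u π e₂, u' e₁, e₃)`. -/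
theorem exists_isMaximalSuborder_of_eq_smul_two {π : R} (hπ : Prime π)
    (hunit : ∀ r : R, ¬ π ∣ r → IsUnit r) (h2 : (2 : R) ≠ 0)
    {O : Subalgebra R B} (hO : IsOrder F O) {a b : R} {e e' : Module.Basis (Fin 4) R O}
    (he : e 0 = 1) (he' : IsGoodBasis a b e')
    (hee' : ∀ i : Fin 4, i ≠ 0 → ∃ x, e' i - e i = π • x) {b' u u' c : R}
    (ha : a ≠ 0) (hb' : b' ≠ 0) (hu : IsUnit u) (hu' : IsUnit u') (hc : IsUnit c)
    (h22 : u' ^ 2 * (a * b) = b') (h32 : u' * a = -(c * (u * π))) {d₁ d₂ d₃ : B}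
    (hd₁ : d₁ = ((u * π) • e 2 : O)) (hd₂ : d₂ = (u' • e 1 : O)) (hd₃ : d₃ = (e 3 : O)) :
    ∃ O' : Subalgebra R B,
      Subalgebra.toSubmodule O' = Submodule.span R {1, d₁, d₂, d₃} ∧
      IsMaximalSuborder F O' O ∧ Corresponds O' a b' := by
  obtain ⟨w, hw⟩ := hu.exists_left_inv
  obtain ⟨w', hw'⟩ := hu'.exists_left_inv
  refine exists_isMaximalSuborder_of_linear hπ.ne_zero h2 hO he he' hee' ha hb' hc
    (fun _ y _ => (u * π) • y) (fun x _ _ => u' • x) (fun _ _ z => z)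
    (by intros; module) (by intros; module) (by intros; module) ?_ rfl rfl rfl ?_ ?_ ?_ ?_
    ![0, 0, 1, 0] rfl ?_ ?_ ?_ (e' 2) ?_ ?_ hd₁ hd₂ hd₃
  · refine fun x y z => ⟨mem_span_quadruple.2 ⟨0, 0, π * w', 0, ?_⟩,
      mem_span_quadruple.2 ⟨0, w, 0, 0, ?_⟩, mem_span_quadruple.2 ⟨0, 0, 0, π, ?_⟩⟩
    · linear_combination (norm := module) (-π * hw') • x
    · linear_combination (norm := module) (-π * hw) • y
    · module
  · rw [he'.e33, Algebra.algebraMap_eq_smul_one]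
  · rw [smul_mul_smul_comm, he'.e11, Algebra.algebraMap_eq_smul_one, smul_smul, ← h22]
    congr 1
    ring
  · rw [mul_smul_comm, he'.e31, smul_neg, smul_smul, smul_smul, h32, neg_smul, neg_neg]
  · rw [smul_mul_assoc, he'.e13, smul_smul, smul_smul, h32, neg_smul]
  · simp
  · simp
  · simp
  · simpa using hπ.not_dvd_one
  · refine fun p q r => ⟨q, 0, ⟨0, 0, p * w', r, ?_⟩, fun h => ?_⟩
    · linear_combination (norm := module) (-p * hw') • e' 1
    · simp only [dvd_zero, and_true] at h
      simpa using hunit q h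

end TableRows

/-! ### The remaining rows and the whole table -/

section TableRows

variable {R : Type v} {F : Type u} {B : Type w} [CommRing R] [IsDomain R] [IsNoetherianRing R]
  [Field F] [Algebra R F] [IsFractionRing R F] [Ring B] [Algebra F B] [Algebra R B]
  [IsScalarTower R F B]

/-- The symmetric matrix with rows `(α₀, α₁)` and `(α₁, α₀)` has determinant `π`, so the index is
`π`. The functional `(α₀, -α₁)` takes the values `π` and `0` on `t₁`, `t₂`, and the unit `α₀` on
`e₁`. -/
theorem exists_isMaximalSuborder_split {π : R} (hπ : Prime π)
    (hunit : ∀ r : R, ¬ π ∣ r → IsUnit r) (h2 : (2 : R) ≠ 0)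
    {O : Subalgebra R B} (hO : IsOrder F O) {s : ℕ} {e e' : Module.Basis (Fin 4) R O}
    (he : e 0 = 1) (he' : IsGoodBasis (-1) (π ^ s) e')
    (hee' : ∀ i : Fin 4, i ≠ 0 → ∃ x, e' i - e i = π • x) {α₀ α₁ : R}
    (hα : α₀ ^ 2 - α₁ ^ 2 = π) {d₁ d₂ d₃ : B}
    (hd₁ : d₁ = (α₀ • e 1 + α₁ • e 2 : O)) (hd₂ : d₂ = (α₁ • e 1 + α₀ • e 2 : O))
    (hd₃ : d₃ = (e 3 : O)) :
    ∃ O' : Subalgebra R B,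
      Subalgebra.toSubmodule O' = Submodule.span R {1, d₁, d₂, d₃} ∧
      IsMaximalSuborder F O' O ∧ Corresponds O' (-1) (π ^ (s + 1)) := by
  have hα₀ : ¬ π ∣ α₀ := by
    rintro ⟨x, rfl⟩
    obtain ⟨y, rfl⟩ : π ∣ α₁ := hπ.dvd_of_dvd_pow (n := 2)
      ⟨π * x ^ 2 - 1, by linear_combination -hα⟩
    refine hπ.not_isUnit (IsUnit.of_mul_eq_one (x ^ 2 - y ^ 2) (mul_left_cancel₀ hπ.ne_zero ?_))
    linear_combination hα
  obtain ⟨k, hk⟩ := (hunit _ hα₀).exists_left_inv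
  refine exists_isMaximalSuborder_of_linear hπ.ne_zero h2 hO he he' hee' (by simp)
    (pow_ne_zero _ hπ.ne_zero) isUnit_one
    (fun x y _ => α₀ • x + α₁ • y) (fun x y _ => α₁ • x + α₀ • y) (fun _ _ z => z)
    (by intros; module) (by intros; module) (by intros; module) ?_ rfl rfl rfl ?_ ?_ ?_ ?_
    ![0, α₀, -α₁, 0] rfl ?_ ?_ ?_ (e' 1) ?_ ?_ hd₁ hd₂ hd₃
  · refine fun x y z => ⟨mem_span_quadruple.2 ⟨0, α₀, -α₁, 0, ?_⟩,
      mem_span_quadruple.2 ⟨0, -α₁, α₀, 0, ?_⟩, mem_span_quadruple.2 ⟨0, 0, 0, π, ?_⟩⟩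
    · rw [← hα]; module
    · rw [← hα]; module
    · module
  · rw [he'.e33, Algebra.algebraMap_eq_smul_one]
  · simp only [mul_add, add_mul, smul_mul_assoc, mul_smul_comm, he'.e11, he'.e12, he'.e21, he'.e22,
      Algebra.algebraMap_eq_smul_one]
    rw [pow_succ, ← hα]
    module
  · simp only [mul_add, mul_smul_comm, he'.e31, he'.e32]
    module
  · simp only [add_mul, smul_mul_assoc, he'.e13, he'.e23]
    module
  · exact ⟨1, by simp [Fin.sum_univ_four, Finsupp.single_apply]; linear_combination hα⟩
  · exact ⟨0, by simp [Fin.sum_univ_four, Finsupp.single_apply]; ring⟩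
  · simp
  · simpa using hα₀
  · refine fun p q r => ⟨p - q * k * α₁, 0, ⟨0, 0, q * k, r, ?_⟩, fun h => ?_⟩
    · linear_combination (norm := module) (-q * hk) • e' 2
    · simp only [dvd_zero, and_true] at h
      simpa using hunit _ h

/-- Here `t₃² = δ`, so `R[t₃]` modulo `π` is the quadratic extension of the residue field. The
quotient is the line over it generated by `e₂`, and `r² - δs²` is a unit off the zero class. -/
theorem exists_isMaximalSuborder_split_unramified {π δ : R} (hπ : Prime π)
    (hunit : ∀ r : R, ¬ π ∣ r → IsUnit r) (h2 : (2 : R) ≠ 0) (hδ' : IsUnit δ)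
    (hδ : ∀ x y : R, π ∣ x ^ 2 - δ * y ^ 2 → π ∣ x ∧ π ∣ y)
    {O : Subalgebra R B} (hO : IsOrder F O) {e e' : Module.Basis (Fin 4) R O}
    (he : e 0 = 1) (he' : IsGoodBasis (-1) 1 e')
    (hee' : ∀ i : Fin 4, i ≠ 0 → ∃ x, e' i - e i = π • x) {β₀ β₁ : R}
    (hβ : β₀ ^ 2 + β₁ ^ 2 = δ) {d₁ d₂ d₃ : B}
    (hd₁ : d₁ = (π • (β₁ • e 1 - β₀ • e 3) : O)) (hd₂ : d₂ = (π • e 2 : O))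
    (hd₃ : d₃ = (β₀ • e 1 + β₁ • e 3 : O)) :
    ∃ O' : Subalgebra R B,
      Subalgebra.toSubmodule O' = Submodule.span R {1, d₁, d₂, d₃} ∧
      IsMaximalSuborder F O' O ∧ Corresponds O' (-δ) (π ^ 2) := by
  have hδ0 : -δ ≠ 0 := neg_ne_zero.2 hδ'.ne_zero
  obtain ⟨k, hk⟩ := hδ'.exists_left_inv
  rw [← hβ] at hk
  refine exists_isMaximalSuborder_of_linear hπ.ne_zero h2 hO he he' hee' hδ0
    (pow_ne_zero _ hπ.ne_zero) isUnit_one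
    (fun x _ z => π • (β₁ • x - β₀ • z)) (fun _ y _ => π • y) (fun x _ z => β₀ • x + β₁ • z)
    (by intros; module) (by intros; module) (by intros; module) ?_ rfl rfl rfl ?_ ?_ ?_ ?_
    ![0, 0, 1, 0] rfl ?_ ?_ ?_ (e' 2) ?_ ?_ hd₁ hd₂ hd₃
  · refine fun x y z => ⟨mem_span_quadruple.2 ⟨0, k * β₁, 0, k * π * β₀, ?_⟩,
      mem_span_quadruple.2 ⟨0, 0, 1, 0, ?_⟩, mem_span_quadruple.2 ⟨0, -k * β₀, 0, k * π * β₁, ?_⟩⟩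
    · linear_combination (norm := module) (-π * hk) • x
    · module
    · linear_combination (norm := module) (-π * hk) • z
  · simp only [mul_add, add_mul, smul_mul_assoc, mul_smul_comm, he'.e11, he'.e13, he'.e31, he'.e33,
      Algebra.algebraMap_eq_smul_one]
    rw [← hβ]
    module
  · simp only [smul_mul_assoc, mul_smul_comm, he'.e22, Algebra.algebraMap_eq_smul_one]
    module
  · simp only [add_mul, smul_mul_assoc, mul_smul_comm, he'.e12, he'.e32]
    module
  · simp only [mul_add, smul_mul_assoc, mul_smul_comm, he'.e21, he'.e23]
    module
  · simp
  · simp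
  · simp [Fin.sum_univ_four, Finsupp.single_apply]
  · simpa using hπ.not_dvd_one
  · refine fun p q r => ⟨q, k * (p * β₁ - r * β₀), ⟨0, 0, 0, k * (p * β₀ + r * β₁), ?_⟩,
      fun h => ?_⟩
    · simp only [add_mul, smul_mul_assoc, he'.e12, he'.e32]
      linear_combination (norm := module) (-p * hk) • e' 1 + (-r * hk) • e' 3
    · exact hunit _ fun h' => h (hδ _ _ (by convert h' using 1; ring))

/-- Again `e₃² = δ`, and since `e₃e₂ = e₁` the quotient is the line generated by `e₂` over the
quadratic residue extension. -/
theorem exists_isMaximalSuborder_unramified {π δ : R} (hπ : Prime π)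
    (hunit : ∀ r : R, ¬ π ∣ r → IsUnit r) (h2 : (2 : R) ≠ 0) (hδ0 : δ ≠ 0)
    (hδ : ∀ x y : R, π ∣ x ^ 2 - δ * y ^ 2 → π ∣ x ∧ π ∣ y)
    {O : Subalgebra R B} (hO : IsOrder F O) {s : ℕ} {e e' : Module.Basis (Fin 4) R O}
    (he : e 0 = 1) (he' : IsGoodBasis (-δ) (π ^ s) e')
    (hee' : ∀ i : Fin 4, i ≠ 0 → ∃ x, e' i - e i = π • x) {d₁ d₂ d₃ : B}
    (hd₁ : d₁ = (π • e 1 : O)) (hd₂ : d₂ = (π • e 2 : O)) (hd₃ : d₃ = (e 3 : O)) :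
    ∃ O' : Subalgebra R B,
      Subalgebra.toSubmodule O' = Submodule.span R {1, d₁, d₂, d₃} ∧
      IsMaximalSuborder F O' O ∧ Corresponds O' (-δ) (π ^ (s + 2)) := by
  refine exists_isMaximalSuborder_of_linear hπ.ne_zero h2 hO he he' hee' (neg_ne_zero.2 hδ0)
    (pow_ne_zero _ hπ.ne_zero) isUnit_one
    (fun x _ _ => π • x) (fun _ y _ => π • y) (fun _ _ z => z)
    (by intros; module) (by intros; module) (by intros; module) ?_ rfl rfl rfl ?_ ?_ ?_ ?_
    ![0, 0, 1, 0] rfl ?_ ?_ ?_ (e' 2) ?_ ?_ hd₁ hd₂ hd₃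
  · refine fun x y z => ⟨mem_span_quadruple.2 ⟨0, 1, 0, 0, ?_⟩,
      mem_span_quadruple.2 ⟨0, 0, 1, 0, ?_⟩, mem_span_quadruple.2 ⟨0, 0, 0, π, ?_⟩⟩ <;> module
  · rw [he'.e33, Algebra.algebraMap_eq_smul_one]
  · simp only [smul_mul_assoc, mul_smul_comm, he'.e22, Algebra.algebraMap_eq_smul_one]
    module
  · rw [mul_smul_comm, he'.e32, one_smul]
  · rw [smul_mul_assoc, he'.e23, one_smul, smul_neg]
  · simp
  · simp
  · simp
  · simpa using hπ.not_dvd_one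
  · refine fun p q r => ⟨q, p, ⟨0, 0, 0, r, ?_⟩, fun h => ?_⟩
    · rw [he'.e32]
      module
    · exact hunit _ fun h' => h (hδ _ _ (by convert h' using 1; ring))

/-- As `e₂`, `e₃` anticommute and both have square `-π`, the combination `β₀e₂ + β₁e₃` has square
`-δπ`. The orthogonal combination `-β₁e₂ + β₀e₃` generates the quotient, and pairing with it gives
the unit `δ`. -/
theorem exists_isMaximalSuborder_ramified {π δ : R} (hπ : Prime π)
    (hunit : ∀ r : R, ¬ π ∣ r → IsUnit r) (h2 : (2 : R) ≠ 0) (hδ' : IsUnit δ)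
    {O : Subalgebra R B} (hO : IsOrder F O) {e e' : Module.Basis (Fin 4) R O}
    (he : e 0 = 1) (he' : IsGoodBasis π π e')
    (hee' : ∀ i : Fin 4, i ≠ 0 → ∃ x, e' i - e i = π • x) {β₀ β₁ : R}
    (hβ : β₀ ^ 2 + β₁ ^ 2 = δ) {d₁ d₂ d₃ : B}
    (hd₁ : d₁ = (π • (-(β₁ • e 2) + β₀ • e 3) : O)) (hd₂ : d₂ = (e 1 : O))
    (hd₃ : d₃ = (β₀ • e 2 + β₁ • e 3 : O)) :
    ∃ O' : Subalgebra R B,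
      Subalgebra.toSubmodule O' = Submodule.span R {1, d₁, d₂, d₃} ∧
      IsMaximalSuborder F O' O ∧ Corresponds O' (δ * π) (π ^ 2) := by
  have hδ1 : ¬ π ∣ δ := fun h => hπ.not_isUnit (isUnit_of_dvd_unit h hδ')
  obtain ⟨k, hk⟩ := hδ'.exists_left_inv
  rw [← hβ] at hk
  refine exists_isMaximalSuborder_of_linear hπ.ne_zero h2 hO he he' hee'
    (mul_ne_zero hδ'.ne_zero hπ.ne_zero) (pow_ne_zero _ hπ.ne_zero) isUnit_one
    (fun _ y z => π • (-(β₁ • y) + β₀ • z)) (fun x _ _ => x) (fun _ y z => β₀ • y + β₁ • z)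
    (by intros; module) (by intros; module) (by intros; module) ?_ rfl rfl rfl ?_ ?_ ?_ ?_
    ![0, 0, -β₁, β₀] rfl ?_ ?_ ?_ (-(β₁ • e' 2) + β₀ • e' 3) ?_ ?_ hd₁ hd₂ hd₃
  · refine fun x y z => ⟨mem_span_quadruple.2 ⟨0, 0, π, 0, ?_⟩,
      mem_span_quadruple.2 ⟨0, -k * β₁, 0, k * π * β₀, ?_⟩,
      mem_span_quadruple.2 ⟨0, k * β₀, 0, k * π * β₁, ?_⟩⟩
    · module
    · linear_combination (norm := module) (-π * hk) • y
    · linear_combination (norm := module) (-π * hk) • z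
  · simp only [mul_add, add_mul, smul_mul_assoc, mul_smul_comm, he'.e22, he'.e23, he'.e32, he'.e33,
      Algebra.algebraMap_eq_smul_one]
    rw [← hβ]
    module
  · rw [he'.e11, Algebra.algebraMap_eq_smul_one, sq]
  · simp only [add_mul, smul_mul_assoc, he'.e21, he'.e31]
    module
  · simp only [mul_add, mul_smul_comm, he'.e12, he'.e13]
    module
  · exact ⟨δ, by simp [Fin.sum_univ_four, Finsupp.single_apply]; linear_combination π * hβ⟩
  · simp
  · exact ⟨0, by simp [Fin.sum_univ_four, Finsupp.single_apply]; ring⟩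
  · convert hδ1 using 2
    simp [Fin.sum_univ_four, Finsupp.single_apply]
    linear_combination hβ
  · refine fun p q r => ⟨k * (r * β₀ - q * β₁), 0, ⟨0, 0, p, k * (q * β₀ + r * β₁), ?_⟩,
      fun h => ?_⟩
    · linear_combination (norm := module) (-q * hk) • e' 2 + (-r * hk) • e' 3
    · simp only [dvd_zero, and_true] at h
      simpa using hunit _ h

/-- Every row of the table gives maximal suborders. -/
theorem SuborderTable.exists_isMaximalSuborder [IsLocalRing R] {π δ : R} (hπ : Prime π)
    (hmax : IsLocalRing.maximalIdeal R = Ideal.span {π}) (h2 : (2 : R) ≠ 0)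
    (hδ' : IsUnit δ) (hδ : ∀ x y : R, π ∣ x ^ 2 - δ * y ^ 2 → π ∣ x ∧ π ∣ y)
    {O : Subalgebra R B} (hO : IsOrder F O) {a b a' b' : R} {e : Module.Basis (Fin 4) R O}
    (he : IsQuasiGoodBasis a b e) {d₁ d₂ d₃ : B}
    (h : SuborderTable π δ (e 1 : B) (e 2 : B) (e 3 : B) a b a' b' d₁ d₂ d₃) :
    ∃ O' : Subalgebra R B,
      Subalgebra.toSubmodule O' = Submodule.span R {1, d₁, d₂, d₃} ∧
      IsMaximalSuborder F O' O ∧ Corresponds O' a' b' := by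
  obtain ⟨he0, e', he', hee'⟩ := he
  have hunit : ∀ r : R, ¬ π ∣ r → IsUnit r := by
    intro r hr
    have : r ∉ IsLocalRing.maximalIdeal R := by rwa [hmax, Ideal.mem_span_singleton]
    exact IsLocalRing.notMem_maximalIdeal.1 this
  have hee' : ∀ i : Fin 4, i ≠ 0 → ∃ x, e' i - e i = π • x := by
    intro i hi
    have h := hee' i hi
    rw [hmax, Submodule.ideal_span_singleton_smul] at h
    obtain ⟨x, -, hx⟩ := (Submodule.mem_smul_pointwise_iff_exists _ _ _).1 h
    exact ⟨x, hx.symm⟩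
  have hπ0 := hπ.ne_zero
  have hδ0 := hδ'.ne_zero
  have hμu : ∀ μ c : R, IsUnit c → μ ^ 2 = c → IsUnit μ := by
    rintro μ c hc rfl
    exact (isUnit_pow_iff two_ne_zero).1 hc
  cases h with
  | A1_A1 s α₀ α₁ hα =>
    exact exists_isMaximalSuborder_split hπ hunit h2 hO he0 he' hee' hα
      (by simp) (by simp) (by simp)
  | A1_A2 β₀ β₁ hβ =>
    exact exists_isMaximalSuborder_split_unramified hπ hunit h2 hδ' hδ hO he0 he' hee' hβ
      (by simp) (by simp) (by simp)
  | A1_B_one h μ hμ =>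
    have hu := hμu μ _ isUnit_one.neg hμ
    exact exists_isMaximalSuborder_of_eq_smul_three hπ hunit h2 hO he0 he' hee' hπ0 hπ0 hu hu
      isUnit_one (by rw [hμ]; ring) (by ring) (by simp) (by simp) (by simp)
  | A1_B_delta h ν hν =>
    have hu := hμu ν _ hδ'.neg hν
    exact exists_isMaximalSuborder_of_eq_smul_three hπ hunit h2 hO he0 he' hee' hπ0
      (mul_ne_zero hδ0 hπ0) hu hu isUnit_one (by rw [hν]; ring) (by ring)
      (by simp) (by simp) (by simp)
  | A2_A2 s hs =>
    exact exists_isMaximalSuborder_unramified hπ hunit h2 hδ0 hδ hO he0 he' hee'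
      (by simp) (by simp) (by simp)
  | A2_B_delta h μ hμ =>
    have hu := hμu μ _ isUnit_one.neg hμ
    exact exists_isMaximalSuborder_of_eq_smul_three hπ hunit h2 hO he0 he' hee' hπ0
      (mul_ne_zero hδ0 hπ0) hu hu isUnit_one (by rw [hμ]; ring) (by ring)
      (by simp) (by simp) (by simp)
  | A2_B_one h ν hν =>
    have hu := hμu ν _ hδ'.neg hν
    have hν' := Ring.mul_inverse_cancel ν hu
    have hu' : IsUnit (Ring.inverse ν) := IsUnit.of_mul_eq_one_right _ hν'
    refine exists_isMaximalSuborder_of_eq_smul_three hπ hunit h2 hO he0 he' hee' hπ0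
      hπ0 hu' hu' isUnit_one ?_ (by ring) (by simp) (by simp) (by simp)
    rw [← neg_eq_iff_eq_neg] at hν
    linear_combination (Ring.inverse ν ^ 2 * π) * hν + π * (ν * Ring.inverse ν + 1) * hν'
  | B_one_C_one =>
    exact exists_isMaximalSuborder_of_eq_smul_two hπ hunit h2 hO he0 he' hee' hπ0
      (pow_ne_zero _ hπ0) isUnit_one isUnit_one isUnit_one.neg (by ring) (by ring)
      (by simp) (by simp) (by simp)
  | B_one_C_delta β₀ β₁ hβ =>
    exact exists_isMaximalSuborder_ramified hπ hunit h2 hδ' hO he0 he' hee' hβ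
      (by simp) (by simp) (by simp)
  | B_delta_C_one =>
    exact exists_isMaximalSuborder_of_eq_smul_two hπ hunit h2 hO he0 he' hee' hπ0
      (mul_ne_zero hδ0 (pow_ne_zero _ hπ0)) isUnit_one isUnit_one isUnit_one.neg (by ring) (by ring)
      (by simp) (by simp) (by simp)
  -- The first coefficient passes from `π` to `b = δπ`, so `e₃` is scaled rather than `e₂`; the
  -- constant is `c = δ` because `e₂e₁ = δπe₃`.
  | B_delta_C_delta =>
    exact exists_isMaximalSuborder_of_eq_smul_three hπ hunit h2 hO he0 he' hee'
      (mul_ne_zero hδ0 hπ0) (mul_ne_zero hδ0 (pow_ne_zero _ hπ0)) isUnit_one isUnit_one hδ'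
      (by ring) (by ring) (by simp) (by simp) (by simp)
  | C_one_one s hs =>
    exact exists_isMaximalSuborder_of_eq_smul_two hπ hunit h2 hO he0 he' hee' hπ0
      (pow_ne_zero _ hπ0) isUnit_one isUnit_one isUnit_one.neg (by ring) (by ring)
      (by simp) (by simp) (by simp)
  | C_delta_one s hs =>
    exact exists_isMaximalSuborder_of_eq_smul_two hπ hunit h2 hO he0 he' hee'
      (mul_ne_zero hδ0 hπ0) (mul_ne_zero hδ0 (pow_ne_zero _ hπ0)) hδ' isUnit_one isUnit_one.neg
      (by ring) (by ring) (by simp) (by simp) (by simp)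
  | C_one_delta s hs =>
    exact exists_isMaximalSuborder_of_eq_smul_two hπ hunit h2 hO he0 he' hee' hπ0
      (mul_ne_zero hδ0 (pow_ne_zero _ hπ0)) isUnit_one isUnit_one isUnit_one.neg (by ring) (by ring)
      (by simp) (by simp) (by simp)
  | C_delta_delta s hs =>
    have hi := Ring.mul_inverse_cancel δ hδ'
    have hu' : IsUnit (Ring.inverse δ) := IsUnit.of_mul_eq_one_right _ hi
    refine exists_isMaximalSuborder_of_eq_smul_two hπ hunit h2 hO he0 he' hee'
      (mul_ne_zero hδ0 hπ0) (pow_ne_zero _ hπ0) hδ' hu' hu'.neg ?_ (by ring)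
      (by simp) (by simp) (by simp)
    linear_combination π ^ (s + 1) * (δ * Ring.inverse δ + 1) * hi

end TableRows

/-- The row comes from the pair of orders witnessing that `g` is beneath `f`, which may lie in
another algebra; maximality is then checked inside the given `O`. -/
theorem mainTheorem3 {R : Type v} {F : Type u} {B : Type w}
    [CommRing R] [IsDomain R] [IsDiscreteValuationRing R]
    [IsAdicComplete (IsLocalRing.maximalIdeal R) R] [Finite (IsLocalRing.ResidueField R)]
    (h2 : IsUnit (2 : R))
    [Field F] [Algebra R F] [IsFractionRing R F]
    [Ring B] [Algebra F B] [Algebra R B] [IsScalarTower R F B] (hB : IsQuaternionAlgebra F B)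
    (π δ : R) (hπ : Irreducible π) (hδ : ¬ IsSquare (IsLocalRing.residue R δ))
    (O : Subalgebra R B) (hO : IsOrder F O)
    (a b a' b' : R) (hf : Corresponds O a b) (hg : IsBeneath F π δ a b a' b')
    (e : Module.Basis (Fin 4) R O) (he : IsQuasiGoodBasis a b e) :
    (∃ d₁ d₂ d₃ : B, SuborderTable π δ (e 1 : B) (e 2 : B) (e 3 : B) a b a' b' d₁ d₂ d₃) ∧
    ∀ d₁ d₂ d₃ : B, SuborderTable π δ (e 1 : B) (e 2 : B) (e 3 : B) a b a' b' d₁ d₂ d₃ →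
      ∃ O' : Subalgebra R B,
        Subalgebra.toSubmodule O' = Submodule.span R {1, d₁, d₂, d₃} ∧
        IsMaximalSuborder F O' O ∧ Corresponds O' a' b' := by
  have hmax := (IsDiscreteValuationRing.irreducible_iff_uniformizer π).1 hπ
  have hδ0 : IsLocalRing.residue R δ ≠ 0 := fun h => hδ (h ▸ IsSquare.zero)
  have hδu : IsUnit δ := by
    by_contra h
    exact hδ0 ((IsLocalRing.residue_eq_zero_iff δ).2 h)
  have hδ' : ¬ π ∣ δ := fun h => hπ.not_isUnit (isUnit_of_dvd_unit h hδu)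
  refine ⟨?_, fun d₁ d₂ d₃ h => h.exists_isMaximalSuborder hπ.prime hmax h2.ne_zero hδu
    (dvd_and_dvd_of_dvd_sq_sub_mul_sq hmax hδ) hO he⟩
  obtain ⟨C⟩ := hg.nonempty_suborderCoords h2 hπ hδ'
  exact SuborderTable.exists_row h2 hπ.prime hmax hδ hg.1 hg.2.1 C _ _ _
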